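/- **Corollary 4 (Mixed Channels and Mixed States).** Let $\mathcal S,\mathcal X,\mathcal Y$ be arbitrary measurable alphabets ($\mathcal X\neq\emptyset$). For every $k,l\in\mathbb N$ let $\mathbf W_k=\{W_k^n:\mathcal X^n\times\mathcal S^n\to\mathcal Y^n\}_n$ be a general channel (an arbitrary sequence of stochastic kernels) and $\mathbf S_l=\{P_{S_l^n}\}_n$ a general state source (an arbitrary sequence of probability laws on $\mathcal S^n$). Let $\alpha_k,\beta_l\ge 0$ with $\sum_k\alpha_k=\sum_l\beta_l=1$, put $\mathcal K=\{k:\alpha_k>0\}$, $\mathcal L=\{l:\beta_l>0\}$, and consider the mixed channel and the mixed state $$W^n=\sum_{k}\alpha_kW_k^n,\qquad P_{S^n}=\sum_l\beta_lP_{S_l^n}.$$ An $(n,M_n,\epsilon_n)$ code consists of a (possibly randomized) encoder $[1:M_n]\times\mathcal S^n\to\mathcal X^n$ and a decoder $\varphi_n:\mathcal Y^n\to[1:M_n]$ whose error probability, averaged over a uniform message that is independent of $S^n\sim P_{S^n}$, is at most $\epsilon_n$. A real number $R\ge0$ is $\epsilon$-achievable if there are $(n,M_n,\epsilon_n)$ codes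 with $\liminf_n\frac1n\log M_n\ge R$ and $\limsup_n\epsilon_n\le\epsilon$; $C_\epsilon$ is the supremum of the $\epsilon$-achievable rates, and the capacity is $C=\lim_{\epsilon\downarrow0}C_\epsilon\in[0,\infty]$. For a sequence of joint laws of $(A^n,B^n)$ let $i_n=\frac1n\log\frac{dP_{A^nB^n}}{d(P_{A^n}\times P_{B^n})}(A^n,B^n)$, with value $+\infty$ on the part of $P_{A^nB^n}$ singular to $P_{A^n}\times P_{B^n}$. Let $\overline I(\mathbf A;\mathbf B)=\inf\{a:\lim_n\mathbb P(i_n>a)=0\}$ (limsup in probability) and $\underline I(\mathbf A;\mathbf B)=-\inf\{a:\lim_n\mathbb P(-i_n>a)=0\}$ (liminf in probability). Then $$C=\sup\Big\{\inf_{(k,l)\in\mathcal K\times\mathcal L}\underline I(\mathbf U_l;\mathbf Y_{kl})-\sup_{l\in\mathcal L}\overline I(\mathbf U_l;\mathbf S_l)\Big\},$$ where the supremum is over all measurable auxiliary alphabets $\mathcal U$ and all sequences of conditional laws $P_{X^n,U^n|S^n}=P_{U^n|S^n}\circ P_{X^n|U^n,S^n}$ with $U^n\in\mathcal U^n$, and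 $(S_l^n,X_l^n,U_l^n,Y_{kl}^n)\sim P_{S_l^n}\circ P_{X^n,U^n|S^n}\circ W_k^n$ (so that $U^n-(X^n,S^n)-Y^n$). Furthermore, if every $\mathbf S_l$ and every $\mathbf W_k$ is stationary and memoryless, i.e. $P_{S_l^n}=\prod_{i=1}^nP_{S_l}$ and $W_k^n(\cdot|x^n,s^n)=\prod_{i=1}^nW_k(\cdot|x_i,s_i)$, then $$C\ge\sup\Big\{\inf_{(k,l)\in\mathcal K\times\mathcal L}I(U_l;Y_{kl})-\sup_{l\in\mathcal L}I(U_l;S_l)\Big\},$$ where the supremum is over all measurable alphabets $\mathcal U$ and all single-letter conditional laws $P_{X,U|S}=P_{U|S}\circ P_{X|U,S}$, $(S_l,X_l,U_l,Y_{kl})\sim P_{S_l}\circ P_{X,U|S}\circ W_k$, and $I$ is mutual information. In both suprema $\infty-\infty$ is read as $-\infty$. -/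

import Mathlib

open MeasureTheory ProbabilityTheory Filter Topology
open scoped ENNReal NNReal

universe u v w z

namespace GP

noncomputable section

/-! ### Limits in probability and information spectra -/

/-- Limsup in probability of a sequence of extended-real random variables `Z n`, where `Z n` lives
on its own space with law `μ n`: the infimum of all `a` with `P(Z n > a) → 0`. -/
def pLimsup {Ω : ℕ → Type*} [∀ n, MeasurableSpace (Ω n)] (μ : ∀ n, Measure (Ω n))
    (Z : ∀ n, Ω n → EReal) : EReal :=
  sInf {a : EReal | Tendsto (fun n => μ n {ω | a < Z n ω}) atTop (𝓝 0)}

/-- Liminf in probability. -/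
def pLiminf {Ω : ℕ → Type*} [∀ n, MeasurableSpace (Ω n)] (μ : ∀ n, Measure (Ω n))
    (Z : ∀ n, Ω n → EReal) : EReal :=
  - pLimsup μ (fun n ω => - Z n ω)

/-- The product of the two marginals of a joint law. -/
def prodMarginals {A B : Type*} [MeasurableSpace A] [MeasurableSpace B]
    (ρ : Measure (A × B)) : Measure (A × B) :=
  ρ.fst.prod ρ.snd

/-- Information density `log (P_{B|A}(b|a) / P_B(b)) = log (dP_{AB} / d(P_A × P_B)) (a, b)` of a
joint law, on arbitrary alphabets. Both laws are differentiated with respect to their sum, so that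
the density is `+∞` on the part of the joint law that is singular to the product of the marginals;
when the joint law is absolutely continuous, this is the logarithm of the Radon-Nikodym derivative
(almost surely). -/
def infoDensity {A B : Type*} [MeasurableSpace A] [MeasurableSpace B]
    (ρ : Measure (A × B)) (p : A × B) : EReal :=
  ENNReal.log (ρ.rnDeriv (ρ + prodMarginals ρ) p /
    (prodMarginals ρ).rnDeriv (ρ + prodMarginals ρ) p)

/-- Spectral sup-mutual information rate of a sequence of joint laws. -/
def spectralSup {A B : ℕ → Type*} [∀ n, MeasurableSpace (A n)] [∀ n, MeasurableSpace (B n)]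
    (ρ : ∀ n, Measure (A n × B n)) : EReal :=
  pLimsup ρ (fun n p => infoDensity (ρ n) p / (n : EReal))

/-- Spectral inf-mutual information rate of a sequence of joint laws. -/
def spectralInf {A B : ℕ → Type*} [∀ n, MeasurableSpace (A n)] [∀ n, MeasurableSpace (B n)]
    (ρ : ∀ n, Measure (A n × B n)) : EReal :=
  pLiminf ρ (fun n p => infoDensity (ρ n) p / (n : EReal))

/-- Mutual information of a joint law (in nats, possibly infinite). -/
def mutualInfo {A B : Type*} [MeasurableSpace A] [MeasurableSpace B]
    (ρ : Measure (A × B)) : ℝ≥0∞ :=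
  InformationTheory.klDiv ρ (prodMarginals ρ)

/-! ### Codes and capacity -/

section Codes

variable {𝒮 : Type u} {𝒳 : Type v} {𝒴 : Type w}
  [MeasurableSpace 𝒮] [MeasurableSpace 𝒳] [MeasurableSpace 𝒴]

/-- A Gel'fand-Pinsker code with `M` messages for one use of a channel with input alphabet `𝒳`,
state alphabet `𝒮` and output alphabet `𝒴`: a (possibly randomized) encoder that sees the message
and the state, and a decoder that sees the channel output. -/
structure Code (𝒮 : Type u) (𝒳 : Type v) (𝒴 : Type w)
    [MeasurableSpace 𝒮] [MeasurableSpace 𝒳] [MeasurableSpace 𝒴] (M : ℕ) where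
  encoder : Fin M → Kernel 𝒮 𝒳
  markov_encoder : ∀ m, IsMarkovKernel (encoder m)
  decoder : 𝒴 → Fin M
  measurable_decoder : Measurable decoder

/-- Average error probability of a code: state law `P`, channel `W(dy|x, s)`, uniform message
independent of the state. -/
def Code.avgError {M : ℕ} (c : Code 𝒮 𝒳 𝒴 M) (W : Kernel (𝒳 × 𝒮) 𝒴) (P : Measure 𝒮) : ℝ≥0∞ :=
  (M : ℝ≥0∞)⁻¹ *
    ∫⁻ s, ∑ m : Fin M, ∫⁻ x, W (x, s) {y | c.decoder y ≠ m} ∂(c.encoder m s) ∂P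

/-- `R` is an `ε`-achievable rate for the general channel `W` and the general state law `P`: there
are `(n, M n, e n)` codes with `liminf (1/n) log (M n) ≥ R` and `limsup (e n) ≤ ε`. -/
def IsAchievable (W : ∀ n, Kernel ((Fin n → 𝒳) × (Fin n → 𝒮)) (Fin n → 𝒴))
    (P : ∀ n, Measure (Fin n → 𝒮)) (ε : ℝ≥0∞) (R : ℝ) : Prop :=
  0 ≤ R ∧ ∃ (M : ℕ → ℕ) (e : ℕ → ℝ≥0∞),
    (∀ n, 0 < M n) ∧
    (∀ n, ∃ c : Code (Fin n → 𝒮) (Fin n → 𝒳) (Fin n → 𝒴) (M n), c.avgError (W n) (P n) ≤ e n) ∧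
    (R : EReal) ≤ liminf (fun n => ((Real.log (M n) / n : ℝ) : EReal)) atTop ∧
    limsup e atTop ≤ ε

/-- The `ε`-capacity, the supremum of all `ε`-achievable rates (an extended real, as the alphabets
may be infinite). -/
def epsCapacity (W : ∀ n, Kernel ((Fin n → 𝒳) × (Fin n → 𝒮)) (Fin n → 𝒴))
    (P : ∀ n, Measure (Fin n → 𝒮)) (ε : ℝ≥0∞) : EReal :=
  sSup {r : EReal | ∃ R : ℝ, IsAchievable W P ε R ∧ r = R}

/-- The capacity, the limit of the `ε`-capacity as `ε` decreases to `0`. -/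
def capacity (W : ∀ n, Kernel ((Fin n → 𝒳) × (Fin n → 𝒮)) (Fin n → 𝒴))
    (P : ∀ n, Measure (Fin n → 𝒮)) : EReal :=
  limUnder (𝓝[>] (0 : ℝ≥0∞)) (epsCapacity W P)

theorem epsCapacity_mono (W : ∀ n, Kernel ((Fin n → 𝒳) × (Fin n → 𝒮)) (Fin n → 𝒴))
    (P : ∀ n, Measure (Fin n → 𝒮)) : Monotone (epsCapacity W P) := by
  intro ε ε' h
  refine sSup_le_sSup ?_
  rintro r ⟨R, ⟨hR, M, e, h1, h2, h3, h4⟩, rfl⟩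
  exact ⟨R, ⟨hR, M, e, h1, h2, h3, h4.trans h⟩, rfl⟩

/-- The limit that defines the capacity exists. -/
theorem tendsto_epsCapacity (W : ∀ n, Kernel ((Fin n → 𝒳) × (Fin n → 𝒮)) (Fin n → 𝒴))
    (P : ∀ n, Measure (Fin n → 𝒮)) :
    Tendsto (epsCapacity W P) (𝓝[>] 0) (𝓝 (capacity W P)) :=
  tendsto_nhds_limUnder ⟨_, (epsCapacity_mono W P).tendsto_nhdsGT 0⟩

end Codes

/-! ### Auxiliary variables and induced joint laws -/

/-- A conditional law `P_{X,U|S} = P_{U|S} ∘ P_{X|U,S}` of a channel input `X` and an auxiliary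
variable `U` given the state `S`. -/
structure TestChannel (𝒮 : Type u) (𝒳 : Type v) (𝒰 : Type z)
    [MeasurableSpace 𝒮] [MeasurableSpace 𝒳] [MeasurableSpace 𝒰] where
  auxKernel : Kernel 𝒮 𝒰
  inputKernel : Kernel (𝒮 × 𝒰) 𝒳
  markov_aux : IsMarkovKernel auxKernel
  markov_input : IsMarkovKernel inputKernel

section TestChannel

variable {𝒮 : Type u} {𝒳 : Type v} {𝒴 : Type w} {𝒰 : Type z}
  [MeasurableSpace 𝒮] [MeasurableSpace 𝒳] [MeasurableSpace 𝒴] [MeasurableSpace 𝒰]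

/-- The conditional law of `(U, X)` given `S`. -/
def TestChannel.law (V : TestChannel 𝒮 𝒳 𝒰) : Kernel 𝒮 (𝒰 × 𝒳) :=
  V.auxKernel ⊗ₖ V.inputKernel

/-- The joint law `P_S ∘ P_{X,U|S} ∘ W` of `((S, (U, X)), Y)`; the output depends on `(U, X, S)`
through `(X, S)` only, so that `U - (X, S) - Y`. -/
def jointLaw (P : Measure 𝒮) (V : TestChannel 𝒮 𝒳 𝒰) (W : Kernel (𝒳 × 𝒮) 𝒴) :
    Measure ((𝒮 × (𝒰 × 𝒳)) × 𝒴) :=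
  (P ⊗ₘ V.law) ⊗ₘ
    (W.comap (fun p : 𝒮 × (𝒰 × 𝒳) => (p.2.2, p.1))
      (measurable_snd.snd.prodMk measurable_fst))

/-- The law of `(U, Y)`. -/
def lawUY (P : Measure 𝒮) (V : TestChannel 𝒮 𝒳 𝒰) (W : Kernel (𝒳 × 𝒮) 𝒴) : Measure (𝒰 × 𝒴) :=
  (jointLaw P V W).map (fun p => (p.1.2.1, p.2))

/-- The law of `(U, S)` (it does not involve the channel). -/
def lawUS (P : Measure 𝒮) (V : TestChannel 𝒮 𝒳 𝒰) : Measure (𝒰 × 𝒮) :=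
  (P ⊗ₘ V.law).map (fun p => (p.2.1, p.1))

/-- On a standard Borel input alphabet, every conditional law of `(U, X)` given `S` is of the form
`P_{U|S} ∘ P_{X|U,S}`. -/
theorem exists_testChannel [StandardBorelSpace 𝒳] [Nonempty 𝒳]
    [MeasurableSpace.CountableOrCountablyGenerated 𝒮 𝒰]
    (κ : Kernel 𝒮 (𝒰 × 𝒳)) [IsMarkovKernel κ] : ∃ V : TestChannel 𝒮 𝒳 𝒰, V.law = κ :=
  ⟨⟨κ.fst, κ.condKernel, inferInstance, inferInstance⟩, κ.disintegrate κ.condKernel⟩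

end TestChannel

/-! ### Mixed channels and mixed states -/

section Mixed

variable {𝒮 : Type u} {𝒳 : Type v} {𝒴 : Type w}
  [MeasurableSpace 𝒮] [MeasurableSpace 𝒳] [MeasurableSpace 𝒴]

/-- The countable mixture `∑ k, α k • κ k` of kernels. -/
def mixKernel {A B : Type*} [MeasurableSpace A] [MeasurableSpace B]
    (α : ℕ → ℝ≥0) (κ : ℕ → Kernel A B) : Kernel A B where
  toFun a := Measure.sum fun k => α k • κ k a
  measurable' := by
    refine Measure.measurable_of_measurable_coe _ fun s hs => ?_
    simp_rw [Measure.sum_apply _ hs]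
    exact Measurable.tsum fun k => ((κ k).measurable_coe hs).const_smul (α k)

/-- The mixed channel `W^n = ∑ k, α k • W_k^n`. -/
def mixChannel (α : ℕ → ℝ≥0)
    (W : ℕ → ∀ n, Kernel ((Fin n → 𝒳) × (Fin n → 𝒮)) (Fin n → 𝒴)) (n : ℕ) :
    Kernel ((Fin n → 𝒳) × (Fin n → 𝒮)) (Fin n → 𝒴) :=
  mixKernel α (fun k => W k n)

/-- The mixed state law `P_{S^n} = ∑ l, β l • P_{S_l^n}`. -/
def mixState (β : ℕ → ℝ≥0) (P : ℕ → ∀ n, Measure (Fin n → 𝒮)) (n : ℕ) : Measure (Fin n → 𝒮) :=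
  Measure.sum fun l => β l • P l n

/-- The general state law `P` is stationary and memoryless with single-letter law `p`. -/
def IsIIDState (P : ∀ n, Measure (Fin n → 𝒮)) (p : Measure 𝒮) : Prop :=
  ∀ n, P n = Measure.pi (fun _ => p)

/-- The general channel `W` is stationary and memoryless with single-letter channel `w`:
`W^n(y|x, s) = ∏ i, w(y i|x i, s i)`. -/
def IsMemorylessChannel (W : ∀ n, Kernel ((Fin n → 𝒳) × (Fin n → 𝒮)) (Fin n → 𝒴))
    (w : Kernel (𝒳 × 𝒮) 𝒴) : Prop :=
  ∀ n x s, W n (x, s) = Measure.pi (fun i => w (x i, s i))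

/-- The value `inf_{(k,l) ∈ K × L} I_(U_l; Y_kl) - sup_{l ∈ L} I^-(U_l; S_l)` of a sequence of
conditional laws `P_{X^n,U^n|S^n}`, where `K` and `L` are the sets of indices of positive weight.
The difference is taken in the extended reals with `∞ - ∞ = -∞`. -/
def spectralValue {𝒰 : Type z} [MeasurableSpace 𝒰] (α β : ℕ → ℝ≥0)
    (W : ℕ → ∀ n, Kernel ((Fin n → 𝒳) × (Fin n → 𝒮)) (Fin n → 𝒴))
    (P : ℕ → ∀ n, Measure (Fin n → 𝒮))
    (V : ∀ n, TestChannel (Fin n → 𝒮) (Fin n → 𝒳) (Fin n → 𝒰)) : EReal :=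
  (⨅ q ∈ {k | 0 < α k} ×ˢ {l | 0 < β l},
      spectralInf (fun n => lawUY (P q.2 n) (V n) (W q.1 n))) -
    ⨆ l ∈ {l | 0 < β l}, spectralSup (fun n => lawUS (P l n) (V n))

/-- The single-letter value `inf_{(k,l) ∈ K × L} I(U_l; Y_kl) - sup_{l ∈ L} I(U_l; S_l)` of a
conditional law `P_{X,U|S}`, with `∞ - ∞ = -∞`. -/
def singleLetterValue {𝒰 : Type z} [MeasurableSpace 𝒰] (α β : ℕ → ℝ≥0)
    (w : ℕ → Kernel (𝒳 × 𝒮) 𝒴) (p : ℕ → Measure 𝒮) (V : TestChannel 𝒮 𝒳 𝒰) : EReal :=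
  ((⨅ q ∈ {k | 0 < α k} ×ˢ {l | 0 < β l}, mutualInfo (lawUY (p q.2) V (w q.1)) : ℝ≥0∞) : EReal) -
    ((⨆ l ∈ {l | 0 < β l}, mutualInfo (lawUS (p l) V) : ℝ≥0∞) : EReal)

end Mixed

end

end GP

/-! Direct part. Each message owns a row of `L` codewords drawn i.i.d. from a law `q` on the
auxiliary alphabet. The encoder picks from the row of its message a codeword that fits the state and
feeds it through the test channel; the decoder looks for a row containing a codeword that fits the
output. A fitting codeword exists with high probability once `L` exceeds exp(n · sup I(U;S)), and
rows are told apart as long as `M * L` stays below exp(n · inf I(U;Y)). The one-shot form is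
`exists_code_le`. It has no Markov lemma: pairs (u, s) whose output is likely to be atypical are
removed from the covering set beforehand, at a cost bounded by Markov's inequality.

Mixtures (`exists_code_mixture_le`). Up to small total weight only finitely many components of
positive weight matter, and the typical sets are unions over these; the number of components is a
constant and does not affect the rate. The codewords follow the mixture `q` of the laws of the U_l.
Covering uses that the law of U_l is at most `q` divided by β_l. Packing needs the reverse: `q` is
at most exp(c) times the law of U_l off a set which that law charges by at most exp(-c), and c = nγ
with small γ is affordable. This gives `spectralValue_le_capacity`.

Converse. The auxiliary variable is the uniform message itself. It is independent of the state, so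
the subtracted term is at most 0, and the Verdú-Han bound of `exists_testChannel_of_code` turns a
small error probability into a large information density. The error of the pair (k, l) is at most
the error of the mixture divided by α_k β_l (`mul_avgError_le`), so vanishing error for the mixture
means vanishing error for every component, with one and the same test channel. This gives
`capacity_le_iSup_spectralValue`.

Memoryless case. The product of a single-letter test channel makes (U, S) and (U, Y) i.i.d. pairs,
and the law of large numbers compares their spectral rates with mutual information. One inequality
for each is enough: `mutualInfo_le_spectralInf_iidPairs` and `spectralSup_iidPairs_le_mutualInfo`.
Both include infinite mutual information. -/

namespace GP

/-! ### Change of measure by the information density -/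

section InfoDensity

variable {A B : Type*} [MeasurableSpace A] [MeasurableSpace B]

instance isProbabilityMeasure_prodMarginals (ρ : Measure (A × B)) [IsProbabilityMeasure ρ] :
    IsProbabilityMeasure (prodMarginals ρ) := by
  unfold prodMarginals; infer_instance

theorem measurable_infoDensity (ρ : Measure (A × B)) : Measurable (infoDensity ρ) := by
  unfold infoDensity
  exact ENNReal.measurable_log.comp
    ((Measure.measurable_rnDeriv _ _).div (Measure.measurable_rnDeriv _ _))

theorem measurableSet_infoDensity_le (ρ : Measure (A × B)) (t : EReal) :
    MeasurableSet {p | infoDensity ρ p ≤ t} :=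
  measurableSet_le (measurable_infoDensity ρ) measurable_const

theorem measurableSet_lt_infoDensity (ρ : Measure (A × B)) (t : EReal) :
    MeasurableSet {p | t < infoDensity ρ p} :=
  measurableSet_lt measurable_const (measurable_infoDensity ρ)

theorem log_le_coe_iff {x : ℝ≥0∞} {t : ℝ} :
    ENNReal.log x ≤ (t : EReal) ↔ x ≤ ENNReal.ofReal (Real.exp t) := by
  rw [← ENNReal.log_le_log_iff, ENNReal.log_ofReal_of_pos (Real.exp_pos t), Real.log_exp]

theorem coe_le_log_iff {x : ℝ≥0∞} {t : ℝ} :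
    (t : EReal) ≤ ENNReal.log x ↔ ENNReal.ofReal (Real.exp t) ≤ x := by
  rw [← ENNReal.log_le_log_iff, ENNReal.log_ofReal_of_pos (Real.exp_pos t), Real.log_exp]

theorem setLIntegral_rnDeriv_add_left {Ω : Type*} [MeasurableSpace Ω] (μ ν : Measure Ω)
    [IsFiniteMeasure μ] [IsFiniteMeasure ν] (E : Set Ω) :
    ∫⁻ x in E, μ.rnDeriv (μ + ν) x ∂(μ + ν) = μ E :=
  Measure.setLIntegral_rnDeriv (Measure.absolutelyContinuous_of_le (Measure.le_add_right le_rfl)) E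

theorem setLIntegral_rnDeriv_add_right {Ω : Type*} [MeasurableSpace Ω] (μ ν : Measure Ω)
    [IsFiniteMeasure μ] [IsFiniteMeasure ν] (E : Set Ω) :
    ∫⁻ x in E, ν.rnDeriv (μ + ν) x ∂(μ + ν) = ν E :=
  Measure.setLIntegral_rnDeriv (Measure.absolutelyContinuous_of_le (Measure.le_add_left le_rfl)) E

/-- Integrate the pointwise inequality between the two densities with respect to the common
dominating measure. No absolute continuity is needed: the bound on the density keeps `E` off the
singular part, where it is `+∞`. The next lemma is the reverse change of measure. -/
theorem measure_le_of_infoDensity_le (ρ : Measure (A × B)) [IsProbabilityMeasure ρ]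
    {E : Set (A × B)} {t : ℝ} (h : ∀ p ∈ E, infoDensity ρ p ≤ t) :
    ρ E ≤ ENNReal.ofReal (Real.exp t) * prodMarginals ρ E := by
  rw [← setLIntegral_rnDeriv_add_left ρ (prodMarginals ρ) E,
    ← setLIntegral_rnDeriv_add_right ρ (prodMarginals ρ) E,
    ← lintegral_const_mul _ (Measure.measurable_rnDeriv _ _)]
  refine setLIntegral_mono (by fun_prop) fun p hp => ?_
  have := log_le_coe_iff.1 (h p hp)
  rwa [ENNReal.div_le_iff_le_mul (Or.inr ENNReal.ofReal_ne_top)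
    (Or.inr (by simp [Real.exp_pos]))] at this

theorem le_measure_of_le_infoDensity (ρ : Measure (A × B)) [IsProbabilityMeasure ρ]
    {E : Set (A × B)} {t : ℝ} (h : ∀ p ∈ E, t ≤ infoDensity ρ p) :
    ENNReal.ofReal (Real.exp t) * prodMarginals ρ E ≤ ρ E := by
  rw [← setLIntegral_rnDeriv_add_left ρ (prodMarginals ρ) E,
    ← setLIntegral_rnDeriv_add_right ρ (prodMarginals ρ) E,
    ← lintegral_const_mul _ (Measure.measurable_rnDeriv _ _)]
  refine setLIntegral_mono (Measure.measurable_rnDeriv _ _) fun p hp => ?_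
  exact ENNReal.mul_le_of_le_div (coe_le_log_iff.1 (h p hp))

end InfoDensity

/-! ### Countable mixtures and their truncation to finitely many components -/

section Mixtures

theorem tsum_coe_eq_one {β : ℕ → ℝ≥0} (hβ : HasSum β 1) : ∑' l, (β l : ℝ≥0∞) = 1 := by
  have := ENNReal.hasSum_coe.2 hβ
  simpa using this.tsum_eq

theorem isProbabilityMeasure_sum_smul {Ω : Type*} [MeasurableSpace Ω] {β : ℕ → ℝ≥0}
    (hβ : HasSum β 1) (P : ℕ → Measure Ω) [∀ l, IsProbabilityMeasure (P l)] :
    IsProbabilityMeasure (Measure.sum fun l => β l • P l) := by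
  constructor
  rw [Measure.sum_apply _ MeasurableSet.univ]
  simpa using tsum_coe_eq_one hβ

theorem isMarkovKernel_mixKernel {A B : Type*} [MeasurableSpace A] [MeasurableSpace B]
    {α : ℕ → ℝ≥0} (hα : HasSum α 1) (κ : ℕ → Kernel A B) [∀ k, IsMarkovKernel (κ k)] :
    IsMarkovKernel (mixKernel α κ) :=
  ⟨fun a => isProbabilityMeasure_sum_smul hα fun k => κ k a⟩

theorem lintegral_sum_smul {Ω : Type*} [MeasurableSpace Ω] (β : ℕ → ℝ≥0) (P : ℕ → Measure Ω)
    (f : Ω → ℝ≥0∞) :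
    ∫⁻ x, f x ∂(Measure.sum fun l => β l • P l) = ∑' l, (β l : ℝ≥0∞) * ∫⁻ x, f x ∂P l := by
  rw [lintegral_sum_measure]
  exact tsum_congr fun l => lintegral_smul_measure _ _

theorem mixKernel_apply {A B : Type*} [MeasurableSpace A] [MeasurableSpace B]
    (α : ℕ → ℝ≥0) (κ : ℕ → Kernel A B) (a : A) {E : Set B} (hE : MeasurableSet E) :
    mixKernel α κ a E = ∑' k, (α k : ℝ≥0∞) * κ k a E := by
  change (Measure.sum fun k => α k • κ k a) E = _
  rw [Measure.sum_apply _ hE]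
  exact tsum_congr fun k => Measure.nnreal_smul_coe_apply _ _ _

/-- A weighted series with terms in `[0, 1]` is at most the weight outside a finite set plus the
terms in this set. -/
theorem tsum_weight_mul_le {β : ℕ → ℝ≥0} {F : Finset ℕ} {ε : ℝ≥0∞}
    (hβ : HasSum β 1) (hF : 1 ≤ ∑ l ∈ F, (β l : ℝ≥0∞) + ε) {f : ℕ → ℝ≥0∞} (hf : ∀ l, f l ≤ 1) :
    ∑' l, (β l : ℝ≥0∞) * f l ≤ ε + ∑ l ∈ F, f l := by
  have h1 := tsum_coe_eq_one hβ
  have hle : ∀ l, (β l : ℝ≥0∞) ≤ 1 := fun l => (ENNReal.le_tsum l).trans h1.le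
  have hsum : ∀ g : ℕ → ℝ≥0∞, ∑' l, (if l ∈ F then g l else 0) = ∑ l ∈ F, g l := fun g => by
    rw [tsum_eq_sum (s := F) fun l hl => if_neg hl]
    exact Finset.sum_congr rfl fun l hl => if_pos hl
  have htail : ∑' l, (if l ∈ F then 0 else (β l : ℝ≥0∞)) ≤ ε := by
    have h2 : ∑' l, (β l : ℝ≥0∞) =
        ∑ l ∈ F, (β l : ℝ≥0∞) + ∑' l, (if l ∈ F then 0 else (β l : ℝ≥0∞)) := by
      rw [← hsum, ← ENNReal.tsum_add]
      exact tsum_congr fun l => by split_ifs <;> simp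
    rw [h1] at h2
    rw [h2] at hF
    exact (ENNReal.add_le_add_iff_left
      (ENNReal.sum_ne_top.2 fun l _ => ENNReal.coe_ne_top)).1 hF
  rw [← hsum f]
  refine le_trans ?_ (add_le_add_left htail _)
  rw [← ENNReal.tsum_add]
  refine ENNReal.tsum_le_tsum fun l => ?_
  split_ifs
  · simpa using mul_le_mul' (hle l) (le_refl (f l))
  · simpa using mul_le_mul' (le_refl (β l : ℝ≥0∞)) (hf l)

theorem exists_finset_weight {β : ℕ → ℝ≥0} (hβ : HasSum β 1) {ε : ℝ≥0∞} (hε : 0 < ε) :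
    ∃ F : Finset ℕ, (∀ l ∈ F, 0 < β l) ∧ 1 ≤ ∑ l ∈ F, (β l : ℝ≥0∞) + ε := by
  have h := ENNReal.hasSum_coe.2 hβ
  have hlt : (1 : ℝ≥0∞) - ε < 1 := ENNReal.sub_lt_self ENNReal.one_ne_top one_ne_zero hε.ne'
  obtain ⟨F, hF⟩ := (h.eventually (lt_mem_nhds (by simpa using hlt))).exists
  refine ⟨F.filter fun l => 0 < β l, fun l hl => (Finset.mem_filter.1 hl).2, ?_⟩
  rw [Finset.sum_filter_of_ne fun l _ hl => pos_iff_ne_zero.2 (by simpa using hl)]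
  exact tsub_le_iff_right.1 hF.le

end Mixtures

attribute [instance] TestChannel.markov_aux TestChannel.markov_input

/-! ### Disintegration of the laws of (U, S) and (U, Y) -/

section Laws

variable {𝒮 : Type u} {𝒳 : Type v} {𝒴 : Type w} {𝒰 : Type z}
  [MeasurableSpace 𝒮] [MeasurableSpace 𝒳] [MeasurableSpace 𝒴] [MeasurableSpace 𝒰]

instance (V : TestChannel 𝒮 𝒳 𝒰) : IsMarkovKernel V.law := by
  unfold TestChannel.law; infer_instance

instance (P : Measure 𝒮) [IsProbabilityMeasure P] (V : TestChannel 𝒮 𝒳 𝒰) :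
    IsProbabilityMeasure (lawUS P V) :=
  Measure.isProbabilityMeasure_map (by fun_prop)

instance (P : Measure 𝒮) [IsProbabilityMeasure P] (V : TestChannel 𝒮 𝒳 𝒰)
    (W : Kernel (𝒳 × 𝒮) 𝒴) [IsMarkovKernel W] : IsProbabilityMeasure (lawUY P V W) := by
  have : IsProbabilityMeasure (jointLaw P V W) := by
    unfold jointLaw; infer_instance
  exact Measure.isProbabilityMeasure_map (by fun_prop)

/-- The conditional law of the channel output given the state and the auxiliary variable. -/
noncomputable def TestChannel.outKernel (V : TestChannel 𝒮 𝒳 𝒰) (W : Kernel (𝒳 × 𝒮) 𝒴) :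
    Kernel (𝒮 × 𝒰) 𝒴 :=
  (V.inputKernel ⊗ₖ W.comap (fun p : (𝒮 × 𝒰) × 𝒳 => (p.2, p.1.1))
    (measurable_snd.prodMk measurable_fst.fst)).snd

instance (V : TestChannel 𝒮 𝒳 𝒰) (W : Kernel (𝒳 × 𝒮) 𝒴) [IsMarkovKernel W] :
    IsMarkovKernel (V.outKernel W) := by
  unfold TestChannel.outKernel; infer_instance

theorem outKernel_apply (V : TestChannel 𝒮 𝒳 𝒰) (W : Kernel (𝒳 × 𝒮) 𝒴) [IsMarkovKernel W]
    (p : 𝒮 × 𝒰) {E : Set 𝒴} (hE : MeasurableSet E) :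
    V.outKernel W p E = ∫⁻ x, W (x, p.1) E ∂V.inputKernel p := by
  rw [TestChannel.outKernel, Kernel.snd_apply' _ _ hE,
    Kernel.compProd_apply (measurable_snd hE)]
  rfl

theorem lawUS_apply (P : Measure 𝒮) [SFinite P] (V : TestChannel 𝒮 𝒳 𝒰) {E : Set (𝒰 × 𝒮)}
    (hE : MeasurableSet E) : lawUS P V E = ∫⁻ s, V.auxKernel s {u | (u, s) ∈ E} ∂P := by
  rw [lawUS, Measure.map_apply (by fun_prop) hE,
    Measure.compProd_apply ((by fun_prop : Measurable fun p : 𝒮 × (𝒰 × 𝒳) => (p.2.1, p.1)) hE)]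
  refine lintegral_congr fun s => ?_
  have h : V.auxKernel s {u | (u, s) ∈ E} = V.law.fst s {u | (u, s) ∈ E} := by
    rw [TestChannel.law, Kernel.fst_compProd]
  rw [h]
  exact (Kernel.fst_apply' _ _ (measurable_prodMk_right hE)).symm

theorem lawUY_apply (P : Measure 𝒮) [SFinite P] (V : TestChannel 𝒮 𝒳 𝒰) (W : Kernel (𝒳 × 𝒮) 𝒴)
    [IsMarkovKernel W] {E : Set (𝒰 × 𝒴)} (hE : MeasurableSet E) :
    lawUY P V W E = ∫⁻ s, ∫⁻ u, V.outKernel W (s, u) {y | (u, y) ∈ E} ∂V.auxKernel s ∂P := by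
  have hE' := (by fun_prop : Measurable fun p : (𝒮 × (𝒰 × 𝒳)) × 𝒴 => (p.1.2.1, p.2)) hE
  rw [lawUY, Measure.map_apply (by fun_prop) hE, jointLaw, Measure.compProd_apply hE',
    Measure.lintegral_compProd (Kernel.measurable_kernel_prodMk_left hE')]
  refine lintegral_congr fun s => ?_
  refine (Kernel.lintegral_compProd _ _ _
    ((Kernel.measurable_kernel_prodMk_left hE').comp measurable_prodMk_left)).trans ?_
  refine lintegral_congr fun u => ?_
  exact (outKernel_apply _ _ _ (measurable_prodMk_left hE)).symm

theorem measurable_outKernel_slice (V : TestChannel 𝒮 𝒳 𝒰) (W : Kernel (𝒳 × 𝒮) 𝒴)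
    [IsMarkovKernel W] {E : Set (𝒰 × 𝒴)} (hE : MeasurableSet E) :
    Measurable fun p : 𝒰 × 𝒮 => V.outKernel W (p.2, p.1) {y | (p.1, y) ∈ E} :=
  Kernel.measurable_kernel_prodMk_left (κ := (V.outKernel W).comap Prod.swap measurable_swap)
    ((by fun_prop : Measurable fun q : (𝒰 × 𝒮) × 𝒴 => (q.1.1, q.2)) hE)

theorem lintegral_lawUS (P : Measure 𝒮) [SFinite P] (V : TestChannel 𝒮 𝒳 𝒰) {f : 𝒰 × 𝒮 → ℝ≥0∞}
    (hf : Measurable f) : ∫⁻ p, f p ∂lawUS P V = ∫⁻ s, ∫⁻ u, f (u, s) ∂V.auxKernel s ∂P := by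
  rw [lawUS, lintegral_map hf (by fun_prop), Measure.lintegral_compProd (by fun_prop)]
  refine lintegral_congr fun s => ?_
  have h : V.auxKernel s = (V.law s).map Prod.fst := by
    rw [← Kernel.map_apply _ measurable_fst, ← Kernel.fst_eq, TestChannel.law, Kernel.fst_compProd]
  rw [h, lintegral_map (by fun_prop) measurable_fst]

theorem lawUY_eq_lintegral_lawUS (P : Measure 𝒮) [SFinite P] (V : TestChannel 𝒮 𝒳 𝒰)
    (W : Kernel (𝒳 × 𝒮) 𝒴) [IsMarkovKernel W] {E : Set (𝒰 × 𝒴)} (hE : MeasurableSet E) :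
    lawUY P V W E = ∫⁻ p, V.outKernel W (p.2, p.1) {y | (p.1, y) ∈ E} ∂lawUS P V := by
  rw [lintegral_lawUS P V (measurable_outKernel_slice V W hE), lawUY_apply P V W hE]

theorem fst_lawUY (P : Measure 𝒮) [SFinite P] (V : TestChannel 𝒮 𝒳 𝒰) (W : Kernel (𝒳 × 𝒮) 𝒴)
    [IsMarkovKernel W] : (lawUY P V W).fst = (lawUS P V).fst := by
  ext E hE
  rw [Measure.fst_apply hE, Measure.fst_apply hE, lawUY_eq_lintegral_lawUS _ _ _ (measurable_fst hE),
    ← lintegral_indicator_one (measurable_fst hE)]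
  refine lintegral_congr fun p => ?_
  by_cases h : p.1 ∈ E <;> simp [h]

theorem snd_lawUS (P : Measure 𝒮) [SFinite P] (V : TestChannel 𝒮 𝒳 𝒰) :
    (lawUS P V).snd = P := by
  ext E hE
  rw [Measure.snd_apply hE, lawUS_apply _ _ (measurable_snd hE), ← lintegral_indicator_one hE]
  refine lintegral_congr fun s => ?_
  by_cases h : s ∈ E <;> simp [h]

theorem lawUS_sum_smul (β : ℕ → ℝ≥0) (P : ℕ → Measure 𝒮) [∀ l, IsProbabilityMeasure (P l)]
    (hβ : HasSum β 1) (V : TestChannel 𝒮 𝒳 𝒰) {E : Set (𝒰 × 𝒮)} (hE : MeasurableSet E) :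
    lawUS (Measure.sum fun l => β l • P l) V E = ∑' l, (β l : ℝ≥0∞) * lawUS (P l) V E := by
  have := isProbabilityMeasure_sum_smul hβ P
  rw [lawUS_apply _ _ hE, lintegral_sum_smul]
  exact tsum_congr fun l => by rw [lawUS_apply _ _ hE]

theorem outKernel_mixKernel (α : ℕ → ℝ≥0) (hα : HasSum α 1) (V : TestChannel 𝒮 𝒳 𝒰)
    (W : ℕ → Kernel (𝒳 × 𝒮) 𝒴) [∀ k, IsMarkovKernel (W k)] (p : 𝒮 × 𝒰) {E : Set 𝒴}
    (hE : MeasurableSet E) :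
    V.outKernel (mixKernel α W) p E = ∑' k, (α k : ℝ≥0∞) * V.outKernel (W k) p E := by
  have := isMarkovKernel_mixKernel hα W
  have hm : ∀ k, Measurable fun x => W k (x, p.1) E := fun k =>
    ((W k).measurable_coe hE).comp measurable_prodMk_right
  simp_rw [outKernel_apply _ _ _ hE, mixKernel_apply α W _ hE]
  rw [lintegral_tsum fun k => ((hm k).const_mul _).aemeasurable]
  exact tsum_congr fun k => lintegral_const_mul _ (hm k)

theorem lawUY_mixture (α β : ℕ → ℝ≥0) (hα : HasSum α 1) (hβ : HasSum β 1)
    (P : ℕ → Measure 𝒮) [∀ l, IsProbabilityMeasure (P l)]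
    (W : ℕ → Kernel (𝒳 × 𝒮) 𝒴) [∀ k, IsMarkovKernel (W k)]
    (V : TestChannel 𝒮 𝒳 𝒰) {E : Set (𝒰 × 𝒴)} (hE : MeasurableSet E) :
    lawUY (Measure.sum fun l => β l • P l) V (mixKernel α W) E =
      ∑' l, (β l : ℝ≥0∞) * ∑' k, (α k : ℝ≥0∞) * lawUY (P l) V (W k) E := by
  have := isProbabilityMeasure_sum_smul hβ P
  have := isMarkovKernel_mixKernel hα W
  rw [lawUY_apply _ _ _ hE, lintegral_sum_smul]
  refine tsum_congr fun l => ?_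
  congr 1
  have h1 : ∀ k, Measurable fun p : 𝒰 × 𝒮 =>
      (α k : ℝ≥0∞) * V.outKernel (W k) (p.2, p.1) {y | (p.1, y) ∈ E} :=
    fun k => (measurable_outKernel_slice V (W k) hE).const_mul _
  have h2 : ∀ s u, V.outKernel (mixKernel α W) (s, u) {y | (u, y) ∈ E} =
      ∑' k, (α k : ℝ≥0∞) * V.outKernel (W k) (s, u) {y | (u, y) ∈ E} :=
    fun s u => outKernel_mixKernel α hα V W _ (measurable_prodMk_left hE)
  simp_rw [h2]
  rw [← lintegral_lawUS (P l) V (f := fun p : 𝒰 × 𝒮 =>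
      ∑' k, (α k : ℝ≥0∞) * V.outKernel (W k) (p.2, p.1) {y | (p.1, y) ∈ E})
      (Measurable.tsum h1), lintegral_tsum fun k => (h1 k).aemeasurable]
  refine tsum_congr fun k => ?_
  rw [lintegral_const_mul _ (measurable_outKernel_slice V (W k) hE),
    lawUY_eq_lintegral_lawUS _ _ _ hE]

end Laws

/-! ### Measurable selection, the covering estimate, and i.i.d. codebooks -/

section Selection

/-- The choice depends on `ω` only through the pattern of sets containing it, and there are finitely
many patterns. Encoder and decoder are both built this way. -/
theorem exists_measurable_choice {Ω ι : Type*} [MeasurableSpace Ω] [Finite ι] [Nonempty ι]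
    [MeasurableSpace ι] {D : ι → Set Ω} (hD : ∀ i, MeasurableSet (D i)) :
    ∃ φ : Ω → ι, Measurable φ ∧ ∀ ω, (∃ i, ω ∈ D i) → ω ∈ D (φ ω) := by
  classical
  let g : (ι → Prop) → ι := fun p => if h : ∃ i, p i then h.choose else Classical.arbitrary ι
  refine ⟨fun ω => g fun i => ω ∈ D i, (measurable_of_countable g).comp
    (measurable_pi_iff.2 fun i => measurableSet_setOfPred.1 (hD i)), fun ω h => ?_⟩
  have : g (fun i => ω ∈ D i) = h.choose := dif_pos h
  change ω ∈ D (g fun i => ω ∈ D i)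
  rw [this]
  exact h.choose_spec

theorem measurable_apply_countable {Ω ι α : Type*} [MeasurableSpace Ω] [Countable ι]
    [MeasurableSpace ι] [MeasurableSingletonClass ι] [MeasurableSpace α] {f : Ω → ι → α}
    (hf : ∀ i, Measurable fun ω => f ω i) {φ : Ω → ι} (hφ : Measurable φ) :
    Measurable fun ω => f ω (φ ω) :=
  (measurable_from_prod_countable_left (f := fun p : Ω × ι => f p.1 p.2) hf).comp
    (measurable_id.prodMk hφ)

/-- Chain (1 - x)^L ≤ exp(-Lx) ≤ exp(-kL/a), then bound the last term by convexity of exp between 0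
and -L/a with weights 1 - k and k. -/
theorem one_sub_pow_le {x k a : ℝ} (L : ℕ) (ha : 0 < a) (hk0 : 0 ≤ k) (hk1 : k ≤ 1)
    (hx1 : x ≤ 1) (hkx : k ≤ a * x) :
    (1 - x) ^ L ≤ Real.exp (-(L / a)) + (1 - k) := by
  have h1 : (1 - x) ^ L ≤ Real.exp (-x) ^ L :=
    pow_le_pow_left₀ (by linarith) (by linarith [Real.add_one_le_exp (-x)]) L
  have h2 : Real.exp (-x) ^ L ≤ Real.exp (k * -(L / a)) := by
    rw [← Real.exp_nat_mul]
    refine Real.exp_le_exp.2 ?_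
    have : k / a ≤ x := by rw [div_le_iff₀ ha]; linarith
    have h3 := mul_le_mul_of_nonneg_left this (Nat.cast_nonneg (α := ℝ) L)
    have h4 : k * -(L / a) = -(L * (k / a)) := by ring
    rw [h4]; linarith
  have h3 := convexOn_exp.2 (Set.mem_univ 0) (Set.mem_univ (-(L / a : ℝ)))
    (sub_nonneg.2 hk1) hk0 (by ring)
  simp only [smul_eq_mul, mul_zero, zero_add, Real.exp_zero, mul_one] at h3
  have h4 : k * Real.exp (-(L / a)) ≤ Real.exp (-(L / a)) :=
    mul_le_of_le_one_left (Real.exp_pos _).le hk1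
  linarith

/-- Covering: the left side is the probability that `L` independent codewords of law `q` all miss
`A`. It is small when `κ` nearly lives on `A`, has density at most `a` against `q` there, and `L` is
much larger than `a`. -/
theorem measure_compl_pow_le {U : Type*} [MeasurableSpace U] (q κ : Measure U)
    [IsProbabilityMeasure q] [IsProbabilityMeasure κ] {A : Set U} (hA : MeasurableSet A)
    {a : ℝ} (ha : 0 < a) (L : ℕ) (h : κ A ≤ ENNReal.ofReal a * q A) :
    (q Aᶜ) ^ L ≤ ENNReal.ofReal (Real.exp (-(L / a))) + κ Aᶜ := by
  have hk : κ.real A ≤ a * q.real A := by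
    have := ENNReal.toReal_mono (by finiteness) h
    rwa [ENNReal.toReal_mul, ENNReal.toReal_ofReal ha.le] at this
  have := one_sub_pow_le L ha measureReal_nonneg measureReal_le_one measureReal_le_one hk
  rw [← ofReal_measureReal (μ := q), ← ofReal_measureReal (μ := κ), ← ENNReal.ofReal_pow
    measureReal_nonneg, ← ENNReal.ofReal_add (Real.exp_pos _).le measureReal_nonneg,
    probReal_compl_eq_one_sub hA, probReal_compl_eq_one_sub hA]
  exact ENNReal.ofReal_le_ofReal this

/-- Two rows of an i.i.d. codebook are independent. -/
theorem lintegral_pi_two_rows {Ω : Type*} [MeasurableSpace Ω] (ν : Measure Ω)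
    [IsProbabilityMeasure ν] {M : ℕ} {i j : Fin M} (hij : i ≠ j) {f : Ω × Ω → ℝ≥0∞}
    (hf : Measurable f) :
    ∫⁻ c, f (c i, c j) ∂Measure.pi (fun _ : Fin M => ν) = ∫⁻ x, ∫⁻ y, f (x, y) ∂ν ∂ν := by
  have hind : iIndepFun (fun (i : Fin M) (c : Fin M → Ω) => c i) (Measure.pi fun _ : Fin M => ν) :=
    iIndepFun_pi (X := fun _ => id) fun _ => aemeasurable_id
  have h1 := (indepFun_iff_map_prod_eq_prod_map_map (measurable_pi_apply i).aemeasurable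
    (measurable_pi_apply j).aemeasurable).1 (hind.indepFun hij)
  have hev : ∀ k : Fin M, (Measure.pi fun _ : Fin M => ν).map (fun c => c k) = ν := fun k =>
    (measurePreserving_eval (fun _ : Fin M => ν) k).map_eq
  rw [hev, hev] at h1
  rw [← lintegral_prod _ hf.aemeasurable, ← h1, lintegral_map hf (by fun_prop)]

theorem lintegral_pi_eval {Ω : Type*} [MeasurableSpace Ω] (ν : Measure Ω)
    [IsProbabilityMeasure ν] {M : ℕ} (i : Fin M) {f : Ω → ℝ≥0∞} (hf : Measurable f) :
    ∫⁻ c, f (c i) ∂Measure.pi (fun _ : Fin M => ν) = ∫⁻ x, f x ∂ν :=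
  (measurePreserving_eval (fun _ : Fin M => ν) i).lintegral_comp hf

end Selection

/-! ### One-shot coding from a random codebook -/

section RandomCoding

variable {𝒮 : Type u} {𝒳 : Type v} {𝒴 : Type w} {𝒰 : Type z}
  [MeasurableSpace 𝒮] [MeasurableSpace 𝒳] [MeasurableSpace 𝒴] [MeasurableSpace 𝒰]

/-- The code of a codebook: the encoder feeds the codeword selected from the row of the message
into the test channel. -/
theorem exists_code_of_codebook (P : Measure 𝒮) (V : TestChannel 𝒮 𝒳 𝒰)
    (W : Kernel (𝒳 × 𝒮) 𝒴) [IsMarkovKernel W] {M L : ℕ} [NeZero M]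
    {T : Set (𝒰 × 𝒴)} (hT : MeasurableSet T) (c : Fin M → Fin L → 𝒰)
    {sel : (Fin L → 𝒰) × 𝒮 → 𝒰} (hsel : Measurable sel) (hmem : ∀ p, ∃ j, sel p = p.1 j) :
    ∃ C : Code 𝒮 𝒳 𝒴 M, C.avgError W P ≤ (M : ℝ≥0∞)⁻¹ *
      ∫⁻ s, ∑ m : Fin M, (V.outKernel W (s, sel (c m, s)) {y | (sel (c m, s), y) ∈ Tᶜ} +
        ∑ m' ∈ Finset.univ.erase m, ∑ j : Fin L,
          V.outKernel W (s, sel (c m, s)) {y | (c m' j, y) ∈ T}) ∂P := by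
  have hD : ∀ m, MeasurableSet {y | ∃ j, (c m j, y) ∈ T} := fun m => by
    rw [Set.ofPred_exists]
    exact MeasurableSet.iUnion fun j => measurable_prodMk_left hT
  obtain ⟨φ, hφ, hφD⟩ := exists_measurable_choice hD
  have hs : ∀ m, Measurable fun s => (s, sel (c m, s)) := fun m =>
    measurable_id.prodMk (hsel.comp measurable_prodMk_left)
  refine ⟨⟨fun m => V.inputKernel.comap (fun s => (s, sel (c m, s))) (hs m), fun m => inferInstance,
    φ, hφ⟩, ?_⟩
  refine mul_le_mul_right (lintegral_mono fun s => Finset.sum_le_sum fun m _ => ?_) _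
  have hE : MeasurableSet {y | φ y ≠ m} := (hφ (measurableSet_singleton m)).compl
  rw [Kernel.comap_apply, ← outKernel_apply V W (s, sel (c m, s)) hE]
  refine (measure_mono (t := {y | (sel (c m, s), y) ∈ Tᶜ} ∪
    ⋃ m' ∈ Finset.univ.erase m, ⋃ j : Fin L, {y | (c m' j, y) ∈ T}) fun y hy => ?_).trans
    ((measure_union_le _ _).trans (add_le_add_right ((measure_biUnion_finset_le _ _).trans
      (Finset.sum_le_sum fun m' _ => (measure_iUnion_le _).trans_eq (tsum_fintype _))) _))
  -- If the sent codeword fits `y`, then some message is a candidate, so the decoded message is one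
  -- too; being wrong, it has a fitting codeword in another row.
  by_cases hyT : (sel (c m, s), y) ∈ T
  · obtain ⟨j, hj⟩ := hmem (c m, s)
    obtain ⟨j', hj'⟩ := hφD y ⟨m, j, by rwa [hj] at hyT⟩
    refine Or.inr (Set.mem_iUnion₂.2 ⟨φ y, Finset.mem_erase.2 ⟨hy, Finset.mem_univ _⟩,
      Set.mem_iUnion.2 ⟨j', hj'⟩⟩)
  · exact Or.inl hyT

/-- One-shot Gel'fand-Pinsker coding. -/
theorem exists_code_le (P : Measure 𝒮) [IsProbabilityMeasure P] (V : TestChannel 𝒮 𝒳 𝒰)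
    (W : Kernel (𝒳 × 𝒮) 𝒴) [IsMarkovKernel W] (q : Measure 𝒰) [IsProbabilityMeasure q]
    {A : Set (𝒰 × 𝒮)} (hA : MeasurableSet A) {T : Set (𝒰 × 𝒴)} (hT : MeasurableSet T)
    {M L : ℕ} (hM : 0 < M) (hL : 0 < L) {a : ℝ} (ha : 0 < a) {b δ : ℝ≥0∞}
    (hcov : ∀ s, V.auxKernel s {u | (u, s) ∈ A} ≤ ENNReal.ofReal a * q {u | (u, s) ∈ A})
    (hpack : ∀ y, q {u | (u, y) ∈ T} ≤ b)
    (hmarkov : ∀ p ∈ A, V.outKernel W (p.2, p.1) {y | (p.1, y) ∈ Tᶜ} ≤ δ) :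
    ∃ C : Code 𝒮 𝒳 𝒴 M, C.avgError W P ≤
      lawUS P V Aᶜ + ENNReal.ofReal (Real.exp (-(L / a))) + δ + M * L * b := by
  have : NeZero M := ⟨hM.ne'⟩
  have : NeZero L := ⟨hL.ne'⟩
  obtain ⟨φ, hφ, hφA⟩ := exists_measurable_choice
    (D := fun (j : Fin L) => {p : (Fin L → 𝒰) × 𝒮 | (p.1 j, p.2) ∈ A})
    fun j => (by fun_prop : Measurable fun p : (Fin L → 𝒰) × 𝒮 => (p.1 j, p.2)) hA
  set sel : (Fin L → 𝒰) × 𝒮 → 𝒰 := fun p => p.1 (φ p)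
  have hsel : Measurable sel :=
    measurable_apply_countable (f := fun p : (Fin L → 𝒰) × 𝒮 => p.1) (fun i => by fun_prop) hφ
  set ν : Measure (Fin L → 𝒰) := Measure.pi fun _ => q
  set G : 𝒰 × 𝒮 → ℝ≥0∞ := fun p => V.outKernel W (p.2, p.1) {y | (p.1, y) ∈ Tᶜ}
  have hG : Measurable G := measurable_outKernel_slice V W hT.compl
  set H : 𝒰 × (𝒰 × 𝒮) → ℝ≥0∞ := fun p => V.outKernel W (p.2.2, p.1) {y | (p.2.1, y) ∈ T}
  have hH : Measurable H := Kernel.measurable_kernel_prodMk_left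
    (κ := (V.outKernel W).comap (fun p : 𝒰 × (𝒰 × 𝒮) => (p.2.2, p.1)) (by fun_prop))
    ((by fun_prop : Measurable fun q : (𝒰 × (𝒰 × 𝒮)) × 𝒴 => (q.1.2.1, q.2)) hT)
  set Φ : (Fin M → Fin L → 𝒰) → 𝒮 → ℝ≥0∞ := fun c s => ∑ m : Fin M, (G (sel (c m, s), s) +
        ∑ m' ∈ Finset.univ.erase m, ∑ j : Fin L, H (sel (c m, s), (c m' j, s))) with hΦ_def
  have hΦ : Measurable (Function.uncurry Φ) := by
    refine Finset.measurable_fun_sum _ fun m _ => Measurable.add (by fun_prop)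
      (Finset.measurable_fun_sum _ fun m' _ => Finset.measurable_fun_sum _ fun j _ => by fun_prop)
  -- If the row meets `A`, the selected codeword lies in `A` and `hmarkov` applies; otherwise
  -- covering has failed.
  have hGint : ∀ s, ∫⁻ d, G (sel (d, s), s) ∂ν ≤
      δ + (ENNReal.ofReal (Real.exp (-(L / a))) + V.auxKernel s {u | (u, s) ∈ A}ᶜ) := by
    intro s
    have hAs : MeasurableSet {u | (u, s) ∈ A} := measurable_prodMk_right hA
    have hB : MeasurableSet (Set.univ.pi fun _ : Fin L => {u | (u, s) ∈ A}ᶜ) :=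
      MeasurableSet.univ_pi fun _ => hAs.compl
    calc ∫⁻ d, G (sel (d, s), s) ∂ν
        ≤ ∫⁻ d, (δ + (Set.univ.pi fun _ : Fin L => {u | (u, s) ∈ A}ᶜ).indicator 1 d) ∂ν := by
          refine lintegral_mono fun d => ?_
          by_cases hd : ∃ j, (d j, s) ∈ A
          · exact (hmarkov (sel (d, s), s) (hφA (d, s) hd)).trans le_self_add
          · have : d ∈ Set.univ.pi fun _ : Fin L => {u | (u, s) ∈ A}ᶜ :=
              fun j _ hj => hd ⟨j, hj⟩
            rw [Set.indicator_of_mem this]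
            exact prob_le_one.trans le_add_self
      _ = δ + (q {u | (u, s) ∈ A}ᶜ) ^ L := by
          rw [lintegral_add_left measurable_const, lintegral_indicator_one hB, Measure.pi_pi]
          simp
      _ ≤ _ := add_le_add_right (measure_compl_pow_le _ _ hAs ha L (hcov s)) _
  -- The output depends on row `m` only, hence is independent of the codewords in row `m'`. By
  -- Fubini, average over the foreign codeword first, where `hpack` applies for every `y`.
  have hHint : ∀ s (m m' : Fin M) (j : Fin L), m' ≠ m →
      ∫⁻ c, H (sel (c m, s), (c m' j, s)) ∂Measure.pi (fun _ : Fin M => ν) ≤ b := by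
    intro s m m' j hm
    rw [lintegral_pi_two_rows ν hm.symm (f := fun p => H (sel (p.1, s), (p.2 j, s)))
      (by fun_prop)]
    refine (lintegral_mono (g := fun _ => b) fun d => ?_).trans_eq (by simp)
    dsimp only
    rw [lintegral_pi_eval q j (f := fun u => H (sel (d, s), (u, s))) (by fun_prop)]
    set κ := V.outKernel W (s, sel (d, s)) with hκ
    have h1 : ∫⁻ u, κ {y | (u, y) ∈ T} ∂q = (q.prod κ) T := (Measure.prod_apply hT).symm
    have h2 : ∫⁻ y, q {u | (u, y) ∈ T} ∂κ = (q.prod κ) T := (Measure.prod_apply_symm hT).symm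
    change ∫⁻ u, κ {y | (u, y) ∈ T} ∂q ≤ b
    rw [h1, ← h2]
    exact (lintegral_mono hpack).trans_eq (by simp)
  have hΦint : ∀ s, ∫⁻ c, Φ c s ∂Measure.pi (fun _ : Fin M => ν) ≤
      M * (δ + (ENNReal.ofReal (Real.exp (-(L / a))) + V.auxKernel s {u | (u, s) ∈ A}ᶜ) +
        M * (L * b)) := by
    intro s
    have hm : ∀ m, Measurable fun c : Fin M → Fin L → 𝒰 => G (sel (c m, s), s) +
        ∑ m' ∈ Finset.univ.erase m, ∑ j : Fin L, H (sel (c m, s), (c m' j, s)) := fun m =>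
      Measurable.add (by fun_prop)
        (Finset.measurable_fun_sum _ fun m' _ => Finset.measurable_fun_sum _ fun j _ => by fun_prop)
    simp only [hΦ_def]
    rw [lintegral_finsetSum _ fun m _ => hm m]
    refine (Finset.sum_le_card_nsmul _ _ _ fun m _ => ?_).trans_eq
      (by rw [Finset.card_univ, Fintype.card_fin, nsmul_eq_mul])
    rw [lintegral_add_left (by fun_prop)]
    refine add_le_add ?_ ?_
    · rw [lintegral_pi_eval ν m (f := fun d => G (sel (d, s), s)) (by fun_prop)]
      exact hGint s
    · rw [lintegral_finsetSum _ fun m' _ => Finset.measurable_fun_sum _ fun j _ => by fun_prop]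
      refine (Finset.sum_le_card_nsmul _ _ (L * b) fun m' hm' => ?_).trans ?_
      · rw [lintegral_finsetSum _ fun j _ => by fun_prop]
        refine (Finset.sum_le_card_nsmul _ _ b fun j _ => hHint s m m' j
          (Finset.ne_of_mem_erase hm')).trans_eq
          (by rw [Finset.card_univ, Fintype.card_fin, nsmul_eq_mul])
      · rw [nsmul_eq_mul]
        gcongr
        simp
  -- Derandomization: some codebook is no worse than the average.
  obtain ⟨c, hc⟩ := exists_le_lintegral (μ := Measure.pi fun _ : Fin M => ν)
    (f := fun c => ∫⁻ s, Φ c s ∂P) hΦ.lintegral_prod_right'.aemeasurable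
  obtain ⟨C, hC⟩ := exists_code_of_codebook P V W hT c hsel fun p => ⟨_, rfl⟩
  refine ⟨C, hC.trans ?_⟩
  have hA' : ∫⁻ s, V.auxKernel s {u | (u, s) ∈ A}ᶜ ∂P = lawUS P V Aᶜ :=
    (lawUS_apply P V hA.compl).symm
  have hmeas : Measurable fun s => V.auxKernel s {u | (u, s) ∈ A}ᶜ :=
    Kernel.measurable_kernel_prodMk_left (measurable_swap hA.compl)
  calc (M : ℝ≥0∞)⁻¹ * ∫⁻ s, Φ c s ∂P
      ≤ (M : ℝ≥0∞)⁻¹ * ∫⁻ s, M * (δ + (ENNReal.ofReal (Real.exp (-(L / a))) +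
          V.auxKernel s {u | (u, s) ∈ A}ᶜ) + M * (L * b)) ∂P := by
        refine mul_le_mul_right (hc.trans ?_) _
        rw [lintegral_lintegral_swap hΦ.aemeasurable]
        exact lintegral_mono hΦint
    _ = δ + (ENNReal.ofReal (Real.exp (-(L / a))) + lawUS P V Aᶜ) + M * (L * b) := by
        rw [lintegral_const_mul _ (by fun_prop), ← mul_assoc, ENNReal.inv_mul_cancel
          (by simpa using hM.ne') (ENNReal.natCast_ne_top M), one_mul,
          lintegral_add_right _ measurable_const, lintegral_add_left measurable_const,
          lintegral_add_left measurable_const, hA']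
        simp
    _ = _ := by ring

end RandomCoding

/-! ### Conditional bounds off null sets, and comparison of a mixture with a component -/

section Slices

theorem exists_measurable_null_compl {Ω : Type*} [MeasurableSpace Ω] {μ : Measure Ω}
    {p : Ω → Prop} (h : ∀ᵐ x ∂μ, p x) :
    ∃ N, MeasurableSet N ∧ μ N = 0 ∧ ∀ x, x ∉ N → p x := by
  obtain ⟨N, hN, hNm, hN0⟩ := exists_measurable_superset_of_null (ae_iff.1 h)
  exact ⟨N, hNm, hN0, fun x hx => by_contra fun hp => hx (hN hp)⟩

/-- Off a null set of `b`, the slices of an event of large information density have small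
probability under the first marginal. -/
theorem exists_null_slice_le_of_lt_infoDensity {A B : Type*} [MeasurableSpace A]
    [MeasurableSpace B] (ρ : Measure (A × B)) [IsProbabilityMeasure ρ] (t : ℝ) :
    ∃ N, MeasurableSet N ∧ ρ.snd N = 0 ∧ ∀ b, b ∉ N →
      ρ.fst {a | t < infoDensity ρ (a, b)} ≤ ENNReal.ofReal (Real.exp (-t)) := by
  have hT := measurableSet_lt_infoDensity ρ t
  have hm : Measurable fun b => ρ.fst {a | t < infoDensity ρ (a, b)} :=
    measurable_measure_prodMk_right hT
  refine exists_measurable_null_compl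
    (ae_le_of_forall_setLIntegral_le_of_sigmaFinite hm fun E hE _ => ?_)
  have hTE := hT.inter (measurable_snd hE : MeasurableSet (Prod.snd ⁻¹' E : Set (A × B)))
  have h1 : ∫⁻ b in E, ρ.fst {a | t < infoDensity ρ (a, b)} ∂ρ.snd =
      prodMarginals ρ ({p | t < infoDensity ρ p} ∩ Prod.snd ⁻¹' E) := by
    rw [prodMarginals, Measure.prod_apply_symm hTE, ← lintegral_indicator hE]
    refine lintegral_congr fun b => ?_
    by_cases hb : b ∈ E
    · rw [Set.indicator_of_mem hb]
      congr 1
      ext a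
      simp [hb]
    · rw [Set.indicator_of_notMem hb]
      symm
      convert measure_empty (μ := ρ.fst)
      ext a
      simp [hb]
  have h2 := le_measure_of_le_infoDensity ρ
    (E := {p | t < infoDensity ρ p} ∩ Prod.snd ⁻¹' E) fun p hp => le_of_lt hp.1
  rw [h1, setLIntegral_const]
  calc prodMarginals ρ ({p | t < infoDensity ρ p} ∩ Prod.snd ⁻¹' E)
      = ENNReal.ofReal (Real.exp (-t)) * (ENNReal.ofReal (Real.exp t) *
          prodMarginals ρ ({p | t < infoDensity ρ p} ∩ Prod.snd ⁻¹' E)) := by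
        rw [← mul_assoc, ← ENNReal.ofReal_mul (Real.exp_pos _).le, ← Real.exp_add]
        simp
    _ ≤ _ := mul_le_mul_right (h2.trans ((measure_mono Set.inter_subset_right).trans_eq
        (Measure.snd_apply hE).symm)) _

variable {𝒮 : Type u} {𝒳 : Type v} {𝒰 : Type z}
  [MeasurableSpace 𝒮] [MeasurableSpace 𝒳] [MeasurableSpace 𝒰]

/-- Integrated over any measurable set of states, both sides become values of the joint law and of
the product of its marginals, where the change of measure applies. The exceptional set is
measurable, so it can be cut out of a typical set. -/
theorem exists_null_auxKernel_slice_le (P : Measure 𝒮) [IsProbabilityMeasure P]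
    (V : TestChannel 𝒮 𝒳 𝒰) (t : ℝ) {D : Set (𝒰 × 𝒮)} (hD : MeasurableSet D)
    (hDt : ∀ p ∈ D, infoDensity (lawUS P V) p ≤ t) :
    ∃ N, MeasurableSet N ∧ P N = 0 ∧ ∀ s, s ∉ N →
      V.auxKernel s {u | (u, s) ∈ D} ≤
        ENNReal.ofReal (Real.exp t) * (lawUS P V).fst {u | (u, s) ∈ D} := by
  have hm1 : Measurable fun s => V.auxKernel s {u | (u, s) ∈ D} :=
    Kernel.measurable_kernel_prodMk_left (measurable_swap hD)
  have hm2 : Measurable fun s => (lawUS P V).fst {u | (u, s) ∈ D} :=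
    measurable_measure_prodMk_right hD
  refine exists_measurable_null_compl
    (ae_le_of_forall_setLIntegral_le_of_sigmaFinite hm1 fun E hE _ => ?_)
  have hDE := hD.inter (measurable_snd hE : MeasurableSet (Prod.snd ⁻¹' E : Set (𝒰 × 𝒮)))
  have key : ∀ (f : 𝒮 → Measure 𝒰), ∫⁻ s in E, f s {u | (u, s) ∈ D} ∂P =
      ∫⁻ s, f s {u | (u, s) ∈ D ∩ Prod.snd ⁻¹' E} ∂P := by
    intro f
    rw [← lintegral_indicator hE]
    refine lintegral_congr fun s => ?_
    by_cases hs : s ∈ E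
    · rw [Set.indicator_of_mem hs]
      congr 1
      ext a
      simp [hs]
    · rw [Set.indicator_of_notMem hs]
      symm
      convert measure_empty (μ := f s)
      ext a
      simp [hs]
  rw [lintegral_const_mul _ hm2, key, key fun _ => (lawUS P V).fst, ← lawUS_apply P V hDE]
  refine (measure_le_of_infoDensity_le (lawUS P V) fun p hp => hDt p hp.1).trans_eq ?_
  rw [prodMarginals, Measure.prod_apply_symm hDE, snd_lawUS]
  rfl

/-- Hahn decomposition of exp(c) ρ - q: on the negative part exp(c) ρ is at most q, hence at most 1.
It transfers packing estimates from the law of a component to the codeword law. -/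
theorem exists_set_le_mul {Ω : Type*} [MeasurableSpace Ω] (q ρ : Measure Ω)
    [IsProbabilityMeasure q] [IsProbabilityMeasure ρ] (c : ℝ) :
    ∃ G, MeasurableSet G ∧
      (∀ E, MeasurableSet E → E ⊆ G → q E ≤ ENNReal.ofReal (Real.exp c) * ρ E) ∧
      ρ Gᶜ ≤ ENNReal.ofReal (Real.exp (-c)) := by
  obtain ⟨G, hG, h1, h2⟩ := hahn_decomposition ((Real.exp c).toNNReal • ρ) q
  refine ⟨G, hG, fun E hE hEG => (h1 E hE hEG).trans_eq (Measure.nnreal_smul_coe_apply _ _ _), ?_⟩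
  have h3 : ENNReal.ofReal (Real.exp c) * ρ Gᶜ ≤ 1 :=
    (Measure.nnreal_smul_coe_apply _ _ _).symm.trans_le ((h2 Gᶜ hG.compl le_rfl).trans prob_le_one)
  calc ρ Gᶜ = ENNReal.ofReal (Real.exp (-c)) * (ENNReal.ofReal (Real.exp c) * ρ Gᶜ) := by
        rw [← mul_assoc, ← ENNReal.ofReal_mul (Real.exp_pos _).le, ← Real.exp_add]
        simp
    _ ≤ ENNReal.ofReal (Real.exp (-c)) * 1 := mul_le_mul_right h3 _
    _ = _ := mul_one _

end Slices

/-! ### One-shot coding for mixtures -/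

section MixedCoding

variable {𝒮 : Type u} {𝒳 : Type v} {𝒴 : Type w} {𝒰 : Type z}
  [MeasurableSpace 𝒮] [MeasurableSpace 𝒳] [MeasurableSpace 𝒴] [MeasurableSpace 𝒰]

/-- The bound on the probability that the auxiliary variable and the output of the mixture are not
jointly typical. -/
noncomputable def packingError (P : ℕ → Measure 𝒮) (V : TestChannel 𝒮 𝒳 𝒰)
    (W : ℕ → Kernel (𝒳 × 𝒮) 𝒴) (FK FL : Finset ℕ) (εα εβ : ℝ≥0∞) (t₁ c : ℝ) : ℝ≥0∞ :=
  εβ + ∑ l ∈ FL, (εα + ∑ k ∈ FK, (lawUY (P l) V (W k)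
    {p | infoDensity (lawUY (P l) V (W k)) p ≤ t₁} + ENNReal.ofReal (Real.exp (-c))))

/-- One-shot Gel'fand-Pinsker coding for mixtures, in terms of the information densities of finitely
many components. -/
theorem exists_code_mixture_le (α β : ℕ → ℝ≥0) (hα : HasSum α 1) (hβ : HasSum β 1)
    (P : ℕ → Measure 𝒮) [∀ l, IsProbabilityMeasure (P l)]
    (W : ℕ → Kernel (𝒳 × 𝒮) 𝒴) [∀ k, IsMarkovKernel (W k)] (V : TestChannel 𝒮 𝒳 𝒰)
    {FK FL : Finset ℕ} (hFL : ∀ l ∈ FL, 0 < β l) {εα εβ : ℝ≥0∞}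
    (hεα : 1 ≤ ∑ k ∈ FK, (α k : ℝ≥0∞) + εα) (hεβ : 1 ≤ ∑ l ∈ FL, (β l : ℝ≥0∞) + εβ)
    (t₁ t₂ c : ℝ) {δ : ℝ≥0∞} (hδ0 : δ ≠ 0) (hδ : δ ≠ ∞) {M L : ℕ} (hM : 0 < M) (hL : 0 < L) :
    ∃ C : Code 𝒮 𝒳 𝒴 M,
      C.avgError (mixKernel α W) (Measure.sum fun l => β l • P l) ≤
      (εβ + ∑ l ∈ FL, lawUS (P l) V {p | t₂ < infoDensity (lawUS (P l) V) p}) +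
        packingError P V W FK FL εα εβ t₁ c / δ +
        ENNReal.ofReal (Real.exp (-(L / ((1 + ∑ l ∈ FL, (β l : ℝ)⁻¹) * Real.exp t₂)))) + δ +
        M * L * (FL.card * (FK.card * ENNReal.ofReal (Real.exp (c - t₁)))) := by
  have hPm := isProbabilityMeasure_sum_smul hβ P
  have hWm := isMarkovKernel_mixKernel hα W
  set Pm := Measure.sum fun l => β l • P l
  set Wm := mixKernel α W
  set q : Measure 𝒰 := Measure.sum fun l => β l • (lawUS (P l) V).fst
  have hq : IsProbabilityMeasure q :=
    isProbabilityMeasure_sum_smul hβ fun l => (lawUS (P l) V).fst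
  choose G hG hGle hGc using fun l => exists_set_le_mul q (lawUS (P l) V).fst c
  choose N hN hN0 hNle using fun k l =>
    exists_null_slice_le_of_lt_infoDensity (lawUY (P l) V (W k)) t₁
  -- Besides large density, `T₁` demands that `u` lie where `q` is comparable with the law of U_l
  -- and that `y` avoid the exceptional null set. Its slices are then small under `q` for every `y`.
  set T₁ : ℕ → ℕ → Set (𝒰 × 𝒴) := fun k l =>
    {p | t₁ < infoDensity (lawUY (P l) V (W k)) p} ∩ (Prod.fst ⁻¹' G l ∩ Prod.snd ⁻¹' (N k l)ᶜ)
  have hT₁ : ∀ k l, MeasurableSet (T₁ k l) := fun k l => (measurableSet_lt_infoDensity _ _).inter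
    ((measurable_fst (hG l)).inter (measurable_snd (hN k l).compl))
  set T : Set (𝒰 × 𝒴) := ⋃ l ∈ FL, ⋃ k ∈ FK, T₁ k l with hT_def
  have hT : MeasurableSet T := FL.measurableSet_biUnion fun l _ =>
    FK.measurableSet_biUnion fun k _ => hT₁ k l
  have hTerr : lawUY Pm V Wm Tᶜ ≤ packingError P V W FK FL εα εβ t₁ c := by
    rw [lawUY_mixture α β hα hβ P W V hT.compl]
    refine (tsum_weight_mul_le hβ hεβ fun l => ?_).trans
      (add_le_add_right (Finset.sum_le_sum fun l hl => ?_) _)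
    · refine (ENNReal.tsum_le_tsum fun k => mul_le_of_le_one_right zero_le prob_le_one).trans_eq
        (tsum_coe_eq_one hα)
    · refine (tsum_weight_mul_le hα hεα fun k => prob_le_one).trans
        (add_le_add_right (Finset.sum_le_sum fun k hk => ?_) _)
      have hsub : Tᶜ ⊆ {p | infoDensity (lawUY (P l) V (W k)) p ≤ t₁} ∪
          (Prod.fst ⁻¹' (G l)ᶜ ∪ Prod.snd ⁻¹' (N k l)) := by
        intro p hp
        by_contra hcon
        simp only [Set.mem_union, not_or, Set.mem_ofPred_eq, not_le, Set.mem_preimage,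
          Set.mem_compl_iff, not_not] at hcon
        exact hp (Set.mem_biUnion hl (Set.mem_biUnion hk ⟨hcon.1, hcon.2.1, hcon.2.2⟩))
      refine (measure_mono hsub).trans ((measure_union_le _ _).trans
        (add_le_add_right ((measure_union_le _ _).trans ?_) _))
      rw [← Measure.fst_apply (hG l).compl, ← Measure.snd_apply (hN k l), hN0, add_zero, fst_lawUY]
      exact hGc l
  have hpack : ∀ y, q {u | (u, y) ∈ T} ≤
      FL.card * (FK.card * ENNReal.ofReal (Real.exp (c - t₁))) := by
    intro y
    have hsl : {u | (u, y) ∈ T} = ⋃ l ∈ FL, ⋃ k ∈ FK, {u | (u, y) ∈ T₁ k l} := by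
      ext u
      simp [hT_def]
    rw [hsl, ← nsmul_eq_mul, ← nsmul_eq_mul]
    refine (measure_biUnion_finset_le _ _).trans (Finset.sum_le_card_nsmul _ _ _ fun l _ =>
      (measure_biUnion_finset_le _ _).trans (Finset.sum_le_card_nsmul _ _ _ fun k _ => ?_))
    by_cases hy : y ∈ N k l
    · have : {u | (u, y) ∈ T₁ k l} = ∅ := by
        ext u
        simp [T₁, hy]
      rw [this]
      simp
    · have h1 := hNle k l y hy
      rw [fst_lawUY] at h1
      refine (hGle l _ (measurable_prodMk_right (hT₁ k l)) fun u hu => hu.2.1).trans ?_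
      rw [sub_eq_add_neg, Real.exp_add, ENNReal.ofReal_mul (Real.exp_pos _).le]
      exact mul_le_mul_right ((measure_mono fun u hu => hu.1).trans h1) _
  -- Probability of an atypical output given the codeword and the state. Its mean is the total
  -- atypicality probability, so Markov's inequality makes {η ≥ δ} rare.
  set η : 𝒰 × 𝒮 → ℝ≥0∞ := fun p => V.outKernel Wm (p.2, p.1) {y | (p.1, y) ∈ Tᶜ}
  have hη : Measurable η := measurable_outKernel_slice V Wm hT.compl
  have hD : MeasurableSet {p | η p ≤ δ} := measurableSet_le hη measurable_const
  have hA₀ : ∀ l, MeasurableSet ({p | infoDensity (lawUS (P l) V) p ≤ t₂} ∩ {p | η p ≤ δ}) :=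
    fun l => (measurableSet_infoDensity_le _ _).inter hD
  choose N' hN' hN'0 hN'le using fun l =>
    exists_null_auxKernel_slice_le (P l) V t₂ (hA₀ l) fun p hp => hp.1
  -- The null set of states is removed so that the covering inequality holds at every `s`.
  set A₁ : ℕ → Set (𝒰 × 𝒮) := fun l =>
    ({p | infoDensity (lawUS (P l) V) p ≤ t₂} ∩ {p | η p ≤ δ}) ∩ Prod.snd ⁻¹' (N' l)ᶜ
  have hA₁ : ∀ l, MeasurableSet (A₁ l) := fun l => (hA₀ l).inter (measurable_snd (hN' l).compl)
  set A : Set (𝒰 × 𝒮) := ⋃ l ∈ FL, A₁ l with hA_def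
  have hA : MeasurableSet A := FL.measurableSet_biUnion fun l _ => hA₁ l
  -- Each β_l⁻¹ is the cost of passing from the law of U_l to `q`; the 1 keeps `a` positive when
  -- `FL` is empty.
  set a : ℝ := (1 + ∑ l ∈ FL, (β l : ℝ)⁻¹) * Real.exp t₂ with ha_def
  have hsum0 : 0 ≤ ∑ l ∈ FL, (β l : ℝ)⁻¹ := Finset.sum_nonneg fun l _ => by positivity
  have ha : 0 < a := by positivity
  have hcov : ∀ s, V.auxKernel s {u | (u, s) ∈ A} ≤ ENNReal.ofReal a * q {u | (u, s) ∈ A} := by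
    intro s
    have hsl : {u | (u, s) ∈ A} = ⋃ l ∈ FL, {u | (u, s) ∈ A₁ l} := by
      ext u
      simp [hA_def]
    have h1 : ∀ l ∈ FL, V.auxKernel s {u | (u, s) ∈ A₁ l} ≤
        ENNReal.ofReal ((β l : ℝ)⁻¹ * Real.exp t₂) * q {u | (u, s) ∈ A} := by
      intro l hl
      by_cases hs : s ∈ N' l
      · have : {u | (u, s) ∈ A₁ l} = ∅ := by
          ext u
          simp [A₁, hs]
        rw [this]
        simp
      · have hsub : {u | (u, s) ∈ A₁ l} ⊆ {u | (u, s) ∈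
            {p | infoDensity (lawUS (P l) V) p ≤ t₂} ∩ {p | η p ≤ δ}} := fun u hu => hu.1
        have hsub' : {u | (u, s) ∈
            {p | infoDensity (lawUS (P l) V) p ≤ t₂} ∩ {p | η p ≤ δ}} ⊆ {u | (u, s) ∈ A} :=
          fun u hu => Set.mem_biUnion hl ⟨hu, hs⟩
        refine (measure_mono hsub).trans ((hN'le l s hs).trans ?_)
        have hβl : (β l : ℝ≥0∞) ≠ 0 := by simpa using (hFL l hl).ne'
        have h2 : (lawUS (P l) V).fst {u | (u, s) ∈ A} ≤
            (β l : ℝ≥0∞)⁻¹ * q {u | (u, s) ∈ A} := by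
          rw [mul_comm, ← div_eq_mul_inv, ENNReal.le_div_iff_mul_le (Or.inl hβl)
            (Or.inl ENNReal.coe_ne_top), mul_comm, ← Measure.nnreal_smul_coe_apply]
          exact Measure.le_sum (fun l => β l • (lawUS (P l) V).fst) l _
        have h3 : ENNReal.ofReal ((β l : ℝ)⁻¹ * Real.exp t₂) =
            ENNReal.ofReal (Real.exp t₂) * (β l : ℝ≥0∞)⁻¹ := by
          rw [mul_comm, ENNReal.ofReal_mul (Real.exp_pos _).le, ENNReal.ofReal_inv_of_pos
            (by exact_mod_cast hFL l hl), ENNReal.ofReal_coe_nnreal]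
        rw [h3, mul_assoc]
        exact mul_le_mul_right ((measure_mono hsub').trans h2) _
    calc V.auxKernel s {u | (u, s) ∈ A}
        ≤ ∑ l ∈ FL, V.auxKernel s {u | (u, s) ∈ A₁ l} := by
          rw [hsl]
          exact measure_biUnion_finset_le _ _
      _ ≤ ∑ l ∈ FL, ENNReal.ofReal ((β l : ℝ)⁻¹ * Real.exp t₂) * q {u | (u, s) ∈ A} :=
          Finset.sum_le_sum h1
      _ = ENNReal.ofReal ((∑ l ∈ FL, (β l : ℝ)⁻¹) * Real.exp t₂) * q {u | (u, s) ∈ A} := by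
          rw [← Finset.sum_mul, ← ENNReal.ofReal_sum_of_nonneg fun l _ => by positivity,
            ← Finset.sum_mul]
      _ ≤ _ := by
          refine mul_le_mul_left (ENNReal.ofReal_le_ofReal ?_) _
          rw [ha_def]
          gcongr
          linarith
  have hmarkov : ∀ p ∈ A, V.outKernel Wm (p.2, p.1) {y | (p.1, y) ∈ Tᶜ} ≤ δ := by
    intro p hp
    obtain ⟨l, _, hl⟩ := Set.mem_iUnion₂.1 hp
    exact hl.1.2
  obtain ⟨C, hC⟩ := exists_code_le Pm V Wm q hA hT hM hL ha hcov hpack hmarkov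
  refine ⟨C, hC.trans ?_⟩
  gcongr
  have hsplit : lawUS Pm V Aᶜ ≤ lawUS Pm V (Aᶜ ∩ {p | η p ≤ δ}) + lawUS Pm V {p | δ ≤ η p} := by
    refine (measure_mono fun p hp => ?_).trans (measure_union_le _ _)
    exact (le_total (η p) δ).imp (fun h => ⟨hp, h⟩) id
  refine hsplit.trans (add_le_add ?_ ?_)
  · rw [lawUS_sum_smul β P hβ V (hA.compl.inter hD)]
    refine (tsum_weight_mul_le hβ hεβ fun l => prob_le_one).trans
      (add_le_add_right (Finset.sum_le_sum fun l hl => ?_) _)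
    have hsub : Aᶜ ∩ {p | η p ≤ δ} ⊆ {p | t₂ < infoDensity (lawUS (P l) V) p} ∪
        Prod.snd ⁻¹' (N' l) := by
      intro p hp
      by_contra hcon
      simp only [Set.mem_union, not_or, Set.mem_ofPred_eq, not_lt] at hcon
      exact hp.1 (Set.mem_biUnion hl ⟨⟨hcon.1, hp.2⟩, hcon.2⟩)
    refine (measure_mono hsub).trans ((measure_union_le _ _).trans_eq ?_)
    rw [← Measure.snd_apply (hN' l), snd_lawUS, hN'0, add_zero]
  · refine (meas_ge_le_lintegral_div hη.aemeasurable hδ0 hδ).trans (ENNReal.div_le_div_right ?_ _)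
    rw [← lawUY_eq_lintegral_lawUS Pm V Wm hT.compl]
    exact hTerr

end MixedCoding

/-! ### Spectral rates as statements on tail probabilities -/

section Spectra

variable {A B : ℕ → Type*} [∀ n, MeasurableSpace (A n)] [∀ n, MeasurableSpace (B n)]

theorem div_natCast_le_iff {x : EReal} {n : ℕ} (hn : 0 < n) {a : ℝ} :
    x / (n : EReal) ≤ a ↔ x ≤ ((n * a : ℝ) : EReal) := by
  rw [EReal.div_le_iff_le_mul (by exact_mod_cast hn) (EReal.natCast_ne_top n), EReal.coe_mul]
  rfl

theorem le_div_natCast_iff {x : EReal} {n : ℕ} (hn : 0 < n) {a : ℝ} :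
    a ≤ x / (n : EReal) ↔ ((n * a : ℝ) : EReal) ≤ x := by
  rw [EReal.le_div_iff_mul_le (by exact_mod_cast hn) (EReal.natCast_ne_top n), mul_comm (n : ℝ),
    EReal.coe_mul]
  rfl

theorem tendsto_of_lt_spectralInf {ρ : ∀ n, Measure (A n × B n)} {a : ℝ}
    (h : (a : EReal) < spectralInf ρ) :
    Tendsto (fun n => ρ n {p | infoDensity (ρ n) p ≤ ((n * a : ℝ) : EReal)}) atTop (𝓝 0) := by
  rw [spectralInf, pLiminf, EReal.lt_neg_comm] at h
  obtain ⟨b, hb, hba⟩ := sInf_lt_iff.1 h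
  refine tendsto_of_tendsto_of_tendsto_of_le_of_le' tendsto_const_nhds hb
    (Eventually.of_forall fun _ => zero_le) ?_
  filter_upwards [eventually_gt_atTop 0] with n hn
  refine measure_mono fun p hp => ?_
  exact hba.trans_le (EReal.neg_le_neg_iff.2 ((div_natCast_le_iff hn).2 hp))

theorem le_spectralInf_of_tendsto {ρ : ∀ n, Measure (A n × B n)} {a : ℝ}
    (h : Tendsto (fun n => ρ n {p | infoDensity (ρ n) p ≤ ((n * a : ℝ) : EReal)}) atTop (𝓝 0)) :
    (a : EReal) ≤ spectralInf ρ := by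
  rw [spectralInf, pLiminf, EReal.le_neg]
  refine sInf_le (tendsto_of_tendsto_of_tendsto_of_le_of_le' tendsto_const_nhds h
    (Eventually.of_forall fun _ => zero_le) ?_)
  filter_upwards [eventually_gt_atTop 0] with n hn
  refine measure_mono fun p hp => ?_
  exact (div_natCast_le_iff hn).1 (EReal.neg_lt_neg_iff.1 hp).le

theorem tendsto_of_spectralSup_lt {ρ : ∀ n, Measure (A n × B n)} {a : ℝ}
    (h : spectralSup ρ < (a : EReal)) :
    Tendsto (fun n => ρ n {p | ((n * a : ℝ) : EReal) < infoDensity (ρ n) p}) atTop (𝓝 0) := by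
  obtain ⟨b, hb, hba⟩ := sInf_lt_iff.1 h
  refine tendsto_of_tendsto_of_tendsto_of_le_of_le' tendsto_const_nhds hb
    (Eventually.of_forall fun _ => zero_le) ?_
  filter_upwards [eventually_gt_atTop 0] with n hn
  refine measure_mono fun p hp => ?_
  exact hba.trans_le ((le_div_natCast_iff hn).2 (le_of_lt hp))

theorem spectralSup_le_of_tendsto {ρ : ∀ n, Measure (A n × B n)} {a : ℝ}
    (h : Tendsto (fun n => ρ n {p | ((n * a : ℝ) : EReal) < infoDensity (ρ n) p}) atTop (𝓝 0)) :
    spectralSup ρ ≤ (a : EReal) := by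
  refine sInf_le (tendsto_of_tendsto_of_tendsto_of_le_of_le' tendsto_const_nhds h
    (Eventually.of_forall fun _ => zero_le) ?_)
  filter_upwards [eventually_gt_atTop 0] with n hn
  refine measure_mono fun p hp => ?_
  exact not_le.1 fun hle => (not_lt.2 ((div_natCast_le_iff hn).2 hle)) hp

theorem tendsto_ofReal_exp_neg {γ : ℝ} (hγ : 0 < γ) :
    Tendsto (fun n : ℕ => ENNReal.ofReal (Real.exp (-(n * γ)))) atTop (𝓝 0) := by
  rw [← ENNReal.ofReal_zero]
  exact ENNReal.tendsto_ofReal (Real.tendsto_exp_neg_atTop_nhds_zero.comp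
    (tendsto_natCast_atTop_atTop.atTop_mul_const hγ))

/-- For a < 0, the event that the density is at most na has probability at most exp(na), which tends
to 0, so the opposite event cannot be negligible. -/
theorem spectralSup_nonneg (ρ : ∀ n, Measure (A n × B n)) [∀ n, IsProbabilityMeasure (ρ n)] :
    0 ≤ spectralSup ρ := by
  by_contra! h
  obtain ⟨a, ha, ha0⟩ := EReal.lt_iff_exists_real_btwn.1 h
  have ha0 : a < 0 := by exact_mod_cast ha0
  have h1 := tendsto_of_spectralSup_lt ha
  have h2 := (tendsto_ofReal_exp_neg (neg_pos.2 ha0)).add h1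
  rw [add_zero] at h2
  have h3 : (1 : ℝ≥0∞) ≤ 0 := by
    refine ge_of_tendsto' h2 fun n => ?_
    rw [← measure_univ (μ := ρ n)]
    refine (measure_mono (t := {p | infoDensity (ρ n) p ≤ ((n * a : ℝ) : EReal)} ∪
      {p | ((n * a : ℝ) : EReal) < infoDensity (ρ n) p}) fun p _ =>
        show _ ∨ _ from le_or_gt (infoDensity (ρ n) p) _).trans
      ((measure_union_le _ _).trans (add_le_add_left ?_ _))
    refine (measure_le_of_infoDensity_le (ρ n) fun p hp => hp).trans ?_
    rw [mul_neg, neg_neg]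
    exact mul_le_of_le_one_right zero_le prob_le_one
  exact absurd h3 (by simp)

/-- The convention ∞ - ∞ = -∞ enters here: it rules out `y = ⊤` whatever `x` is. -/
theorem exists_reals_of_lt_sub {x y : EReal} {r : ℝ} (hy : 0 ≤ y) (h : (r : EReal) < x - y) :
    ∃ a₁ a₂ : ℝ, (a₁ : EReal) < x ∧ y < (a₂ : EReal) ∧ 0 ≤ a₂ ∧ r + a₂ < a₁ := by
  induction y with
  | bot => simp at hy
  | top => simp at h
  | coe y =>
    rw [EReal.lt_sub_iff_add_lt (Or.inr (EReal.coe_ne_top _)) (Or.inr (EReal.coe_ne_bot _)),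
      ← EReal.coe_add] at h
    obtain ⟨b, hb, hbx⟩ := EReal.lt_iff_exists_real_btwn.1 h
    have hb : r + y < b := by exact_mod_cast hb
    have hy : 0 ≤ y := by exact_mod_cast hy
    refine ⟨b, y + (b - r - y) / 2, hbx, ?_, by linarith, by linarith⟩
    exact_mod_cast (by linarith : y < y + (b - r - y) / 2)

end Spectra

/-! ### Direct part -/

section Direct

variable {𝒮 : Type u} {𝒳 : Type v} {𝒴 : Type w} {𝒰 : Type z}
  [MeasurableSpace 𝒮] [MeasurableSpace 𝒳] [MeasurableSpace 𝒴] [MeasurableSpace 𝒰]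

instance [Nonempty 𝒳] (M : ℕ) [NeZero M] : Nonempty (Code 𝒮 𝒳 𝒴 M) :=
  ⟨⟨fun _ => Kernel.const 𝒮 (Measure.dirac (Classical.arbitrary 𝒳)), fun _ => inferInstance,
    fun _ => 0, measurable_const⟩⟩

theorem natCeil_exp_le {t : ℝ} (ht : 0 ≤ t) : (⌈Real.exp t⌉₊ : ℝ) ≤ 2 * Real.exp t := by
  have := Nat.ceil_lt_add_one (Real.exp_pos t).le
  linarith [Real.one_le_exp ht]

theorem le_capacity_of_eventually_exists_code [Nonempty 𝒳]
    (W : ∀ n, Kernel ((Fin n → 𝒳) × (Fin n → 𝒮)) (Fin n → 𝒴)) (P : ∀ n, Measure (Fin n → 𝒮))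
    {r : ℝ} (hr : 0 ≤ r)
    (h : ∀ ε : ℝ, 0 < ε → ∀ᶠ n : ℕ in atTop,
      ∃ C : Code (Fin n → 𝒮) (Fin n → 𝒳) (Fin n → 𝒴) ⌈Real.exp (n * r)⌉₊,
        C.avgError (W n) (P n) ≤ ENNReal.ofReal ε) :
    (r : EReal) ≤ capacity W P := by
  have hM : ∀ n : ℕ, 0 < ⌈Real.exp (n * r)⌉₊ := fun n => Nat.ceil_pos.2 (Real.exp_pos _)
  have : ∀ n : ℕ, NeZero ⌈Real.exp (n * r)⌉₊ := fun n => ⟨(hM n).ne'⟩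
  refine ge_of_tendsto (tendsto_epsCapacity W P) ?_
  filter_upwards [self_mem_nhdsWithin] with ε hε
  obtain ⟨e, he0, heε⟩ : ∃ e : ℝ, 0 < e ∧ ENNReal.ofReal e ≤ ε := by
    obtain ⟨e, he0, he⟩ := ENNReal.lt_iff_exists_real_btwn.1 (show (0 : ℝ≥0∞) < ε from hε)
    exact ⟨e, ENNReal.ofReal_pos.1 he.1, he.2.le⟩
  -- A code is needed for every `n`. Where no good one exists an arbitrary code serves, which the
  -- limsup does not see.
  have hc : ∀ n : ℕ, ∃ C : Code (Fin n → 𝒮) (Fin n → 𝒳) (Fin n → 𝒴) ⌈Real.exp (n * r)⌉₊,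
      (∃ C : Code (Fin n → 𝒮) (Fin n → 𝒳) (Fin n → 𝒴) ⌈Real.exp (n * r)⌉₊,
        C.avgError (W n) (P n) ≤ ENNReal.ofReal e) → C.avgError (W n) (P n) ≤ ENNReal.ofReal e := by
    intro n
    by_cases hn : ∃ C : Code (Fin n → 𝒮) (Fin n → 𝒳) (Fin n → 𝒴) ⌈Real.exp (n * r)⌉₊,
        C.avgError (W n) (P n) ≤ ENNReal.ofReal e
    · exact ⟨hn.choose, fun _ => hn.choose_spec⟩
    · exact ⟨Classical.arbitrary _, fun hn' => absurd hn' hn⟩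
  choose C hC using hc
  refine le_sSup ⟨r, ⟨hr, fun n => ⌈Real.exp (n * r)⌉₊, fun n => (C n).avgError (W n) (P n), hM,
    fun n => ⟨C n, le_rfl⟩, ?_, ?_⟩, rfl⟩
  · refine le_liminf_of_le (by isBoundedDefault) ?_
    filter_upwards [eventually_gt_atTop 0] with n hn
    have hn' : (0 : ℝ) < n := by exact_mod_cast hn
    refine EReal.coe_le_coe_iff.2 ((le_div_iff₀ hn').2 ?_)
    rw [Real.le_log_iff_exp_le (by exact_mod_cast hM n), mul_comm]
    exact Nat.le_ceil _
  · refine limsup_le_of_le (by isBoundedDefault) ?_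
    filter_upwards [h e he0] with n hn
    exact (hC n hn).trans heε

theorem capacity_nonneg [Nonempty 𝒳]
    (W : ∀ n, Kernel ((Fin n → 𝒳) × (Fin n → 𝒮)) (Fin n → 𝒴)) (P : ∀ n, Measure (Fin n → 𝒮)) :
    0 ≤ capacity W P := by
  have h := le_capacity_of_eventually_exists_code W P le_rfl fun ε hε =>
    Eventually.of_forall fun n => ?_
  · exact_mod_cast h
  · have h1 : ⌈Real.exp (n * 0)⌉₊ = 1 := by simp
    rw [h1]
    refine ⟨Classical.arbitrary _, ?_⟩
    have h2 : ∀ (C : Code (Fin n → 𝒮) (Fin n → 𝒳) (Fin n → 𝒴) 1) (m : Fin 1),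
        {y | C.decoder y ≠ m} = ∅ := fun C m => by
      ext y
      simp [Subsingleton.elim (C.decoder y) m]
    simp [Code.avgError, h2]

theorem eventually_exists_code (α β : ℕ → ℝ≥0) (hα : HasSum α 1) (hβ : HasSum β 1)
    (W : ℕ → ∀ n, Kernel ((Fin n → 𝒳) × (Fin n → 𝒮)) (Fin n → 𝒴))
    (hW : ∀ k n, IsMarkovKernel (W k n))
    (P : ℕ → ∀ n, Measure (Fin n → 𝒮)) (hP : ∀ l n, IsProbabilityMeasure (P l n))
    (V : ∀ n, TestChannel (Fin n → 𝒮) (Fin n → 𝒳) (Fin n → 𝒰))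
    {r a₁ a₂ : ℝ} (hr : 0 ≤ r) (ha₂ : 0 ≤ a₂) (hlt : r + a₂ < a₁)
    (hUY : ∀ k l, 0 < α k → 0 < β l → Tendsto (fun n => lawUY (P l n) (V n) (W k n)
      {p | infoDensity (lawUY (P l n) (V n) (W k n)) p ≤ ((n * a₁ : ℝ) : EReal)}) atTop (𝓝 0))
    (hUS : ∀ l, 0 < β l → Tendsto (fun n => lawUS (P l n) (V n)
      {p | ((n * a₂ : ℝ) : EReal) < infoDensity (lawUS (P l n) (V n)) p}) atTop (𝓝 0))
    {ε : ℝ} (hε : 0 < ε) :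
    ∀ᶠ n : ℕ in atTop, ∃ C : Code (Fin n → 𝒮) (Fin n → 𝒳) (Fin n → 𝒴) ⌈Real.exp (n * r)⌉₊,
      C.avgError (mixChannel α W n) (mixState β P n) ≤ ENNReal.ofReal ε := by
  -- The gap is split in three: one γ for the excess of `L` over exp(n a₂), one for the change of
  -- measure c = nγ, and one left as the decay rate of the packing term.
  set γ : ℝ := (a₁ - a₂ - r) / 3 with hγ_def
  have hγ : 0 < γ := by rw [hγ_def]; linarith
  -- With δ = ε/4, the limiting bound is at most τ + 2τ/δ + δ ≤ 3ε/4.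
  set τ : ℝ := min (ε / 4) (ε ^ 2 / 32) with hτ_def
  have hτ : 0 < τ := by rw [hτ_def]; positivity
  obtain ⟨FL, hFL, hFL1⟩ := exists_finset_weight hβ (ENNReal.ofReal_pos.2 hτ)
  -- The neglected channel weight is counted once for each `l ∈ FL`, so `FK` is chosen after `FL`
  -- with this tolerance.
  have hτL : 0 < τ / (FL.card + 1) := by positivity
  obtain ⟨FK, hFK, hFK1⟩ := exists_finset_weight hα (ENNReal.ofReal_pos.2 hτL)
  set B : ℝ := 1 + ∑ l ∈ FL, (β l : ℝ)⁻¹ with hB_def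
  have hB : 0 < B := by
    have : 0 ≤ ∑ l ∈ FL, (β l : ℝ)⁻¹ := Finset.sum_nonneg fun l _ => by positivity
    linarith
  have hδ0 : ENNReal.ofReal (ε / 4) ≠ 0 := by simpa using hε
  have hpe : Tendsto (fun n => packingError (fun l => P l n) (V n) (fun k => W k n) FK FL
      (ENNReal.ofReal (τ / (FL.card + 1))) (ENNReal.ofReal τ) (n * a₁) (n * γ)) atTop
      (𝓝 (ENNReal.ofReal τ + ∑ l ∈ FL, (ENNReal.ofReal (τ / (FL.card + 1)) +
        ∑ k ∈ FK, (0 + 0)))) :=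
    tendsto_const_nhds.add (tendsto_finsetSum _ fun l hl => tendsto_const_nhds.add
      (tendsto_finsetSum _ fun k hk =>
        (hUY k l (hFK k hk) (hFL l hl)).add (tendsto_ofReal_exp_neg hγ)))
  have hcov : Tendsto (fun n : ℕ => ENNReal.ofReal (Real.exp (-((⌈Real.exp (n * (a₂ + γ))⌉₊ : ℝ) /
      (B * Real.exp (n * a₂)))))) atTop (𝓝 0) := by
    rw [← ENNReal.ofReal_zero]
    refine ENNReal.tendsto_ofReal (Real.tendsto_exp_neg_atTop_nhds_zero.comp
      (tendsto_atTop_mono (f := fun n : ℕ => Real.exp (n * γ) / B) (fun n => ?_) ?_))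
    · rw [div_le_div_iff₀ hB (by positivity)]
      have h1 : Real.exp (n * (a₂ + γ)) = Real.exp (n * γ) * Real.exp (n * a₂) := by
        rw [← Real.exp_add]; ring_nf
      calc Real.exp (n * γ) * (B * Real.exp (n * a₂)) = Real.exp (n * (a₂ + γ)) * B := by
            rw [h1]; ring
        _ ≤ _ := by gcongr; exact Nat.le_ceil _
    · exact (Real.tendsto_exp_atTop.comp
        (tendsto_natCast_atTop_atTop.atTop_mul_const hγ)).atTop_div_const hB
  have hpack : Tendsto (fun n : ℕ => (⌈Real.exp (n * r)⌉₊ : ℝ≥0∞) * ⌈Real.exp (n * (a₂ + γ))⌉₊ *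
      (FL.card * (FK.card * ENNReal.ofReal (Real.exp (n * γ - n * a₁))))) atTop (𝓝 0) := by
    have h0 : Tendsto (fun n : ℕ => (4 * FL.card * FK.card : ℝ≥0∞) *
        ENNReal.ofReal (Real.exp (-(n * γ)))) atTop (𝓝 0) := by
      have := ENNReal.Tendsto.const_mul (a := (4 * FL.card * FK.card : ℝ≥0∞))
        (tendsto_ofReal_exp_neg hγ) (Or.inr (by finiteness))
      rwa [mul_zero] at this
    refine tendsto_of_tendsto_of_tendsto_of_le_of_le tendsto_const_nhds h0
      (fun _ => zero_le) fun n => ?_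
    have h1 : ∀ t : ℝ, 0 ≤ t → (⌈Real.exp t⌉₊ : ℝ≥0∞) ≤ 2 * ENNReal.ofReal (Real.exp t) := by
      intro t ht
      rw [← ENNReal.ofReal_natCast, ← ENNReal.ofReal_ofNat, ← ENNReal.ofReal_mul (by norm_num)]
      exact ENNReal.ofReal_le_ofReal (natCeil_exp_le ht)
    have h2 : ENNReal.ofReal (Real.exp (n * r)) * ENNReal.ofReal (Real.exp (n * (a₂ + γ))) *
        ENNReal.ofReal (Real.exp (n * γ - n * a₁)) = ENNReal.ofReal (Real.exp (-(n * γ))) := by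
      rw [← ENNReal.ofReal_mul (Real.exp_pos _).le, ← Real.exp_add,
        ← ENNReal.ofReal_mul (Real.exp_pos _).le, ← Real.exp_add]
      congr 2
      rw [hγ_def]
      ring
    dsimp only
    rw [← h2]
    refine (mul_le_mul_left (mul_le_mul' (h1 _ (by positivity)) (h1 _ (by positivity))) _).trans_eq
      ?_
    ring
  have hbound := (((((tendsto_const_nhds (x := ENNReal.ofReal τ)).add
    (tendsto_finsetSum FL fun l hl => hUS l (hFL l hl))).add
    (ENNReal.Tendsto.div_const hpe (Or.inr hδ0))).add hcov).add
    (tendsto_const_nhds (x := ENNReal.ofReal (ε / 4)))).add hpack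
  have hlim : ENNReal.ofReal τ + ∑ l ∈ FL, (0 : ℝ≥0∞) + (ENNReal.ofReal τ + ∑ l ∈ FL,
      (ENNReal.ofReal (τ / (FL.card + 1)) + ∑ k ∈ FK, (0 + 0))) / ENNReal.ofReal (ε / 4) + 0 +
      ENNReal.ofReal (ε / 4) + 0 < ENNReal.ofReal ε := by
    have h1 : (ENNReal.ofReal τ + ∑ l ∈ FL,
      (ENNReal.ofReal (τ / (FL.card + 1)) + ∑ k ∈ FK, ((0 : ℝ≥0∞) + 0))) ≤
        ENNReal.ofReal (2 * τ) := by
      simp only [add_zero, Finset.sum_const_zero, Finset.sum_const, nsmul_eq_mul]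
      rw [← ENNReal.ofReal_natCast, ← ENNReal.ofReal_mul (by positivity),
        ← ENNReal.ofReal_add hτ.le (by positivity)]
      refine ENNReal.ofReal_le_ofReal ?_
      have : (FL.card : ℝ) * (τ / (FL.card + 1)) ≤ τ := by
        rw [mul_div_assoc', div_le_iff₀ (by positivity)]
        nlinarith
      linarith
    have h2 : ENNReal.ofReal (2 * τ) / ENNReal.ofReal (ε / 4) ≤ ENNReal.ofReal (ε / 4) := by
      rw [← ENNReal.ofReal_div_of_pos (by positivity)]
      refine ENNReal.ofReal_le_ofReal ((div_le_iff₀ (by positivity)).2 ?_)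
      have := min_le_right (ε / 4) (ε ^ 2 / 32)
      rw [← hτ_def] at this
      linarith [sq (ε / 4), sq ε]
    have h3 : ENNReal.ofReal τ ≤ ENNReal.ofReal (ε / 4) :=
      ENNReal.ofReal_le_ofReal (min_le_left _ _)
    simp only [Finset.sum_const_zero, add_zero] at h1 ⊢
    calc _ ≤ ENNReal.ofReal (ε / 4) + ENNReal.ofReal (ε / 4) + ENNReal.ofReal (ε / 4) := by
          gcongr
          exact (ENNReal.div_le_div_right h1 _).trans h2
      _ = ENNReal.ofReal (3 * (ε / 4)) := by
          rw [← ENNReal.ofReal_add (by positivity) (by positivity),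
            ← ENNReal.ofReal_add (by positivity) (by positivity)]
          congr 1
          ring
      _ < _ := (ENNReal.ofReal_lt_ofReal_iff hε).2 (by linarith)
  filter_upwards [hbound.eventually (gt_mem_nhds hlim)] with n hn
  obtain ⟨C, hC⟩ := exists_code_mixture_le α β hα hβ (fun l => P l n) (fun k => W k n) (V n) hFL hFK1
    hFL1 (n * a₁) (n * a₂) (n * γ) hδ0 ENNReal.ofReal_ne_top
    (M := ⌈Real.exp (n * r)⌉₊) (L := ⌈Real.exp (n * (a₂ + γ))⌉₊)
    (Nat.ceil_pos.2 (Real.exp_pos _)) (Nat.ceil_pos.2 (Real.exp_pos _))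
  exact ⟨C, hC.trans hn.le⟩

theorem spectralValue_le_capacity [Nonempty 𝒳] (α β : ℕ → ℝ≥0) (hα : HasSum α 1)
    (hβ : HasSum β 1)
    (W : ℕ → ∀ n, Kernel ((Fin n → 𝒳) × (Fin n → 𝒮)) (Fin n → 𝒴))
    (hW : ∀ k n, IsMarkovKernel (W k n))
    (P : ℕ → ∀ n, Measure (Fin n → 𝒮)) (hP : ∀ l n, IsProbabilityMeasure (P l n))
    (V : ∀ n, TestChannel (Fin n → 𝒮) (Fin n → 𝒳) (Fin n → 𝒰)) :
    spectralValue α β W P V ≤ capacity (mixChannel α W) (mixState β P) := by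
  by_contra! h
  obtain ⟨r, hr, hrV⟩ := EReal.lt_iff_exists_real_btwn.1 h
  have hr0 : 0 ≤ r := by exact_mod_cast (capacity_nonneg _ _).trans hr.le
  have hl : ∃ l, 0 < β l := by
    by_contra! h0
    have : β = 0 := funext fun l => le_antisymm (h0 l) zero_le
    rw [this] at hβ
    exact zero_ne_one (hasSum_zero.unique hβ)
  obtain ⟨l₀, hl₀⟩ := hl
  have hnn : 0 ≤ ⨆ l ∈ {l | 0 < β l}, spectralSup (fun n => lawUS (P l n) (V n)) :=
    (spectralSup_nonneg _).trans
      (le_iSup₂ (f := fun l (_ : l ∈ {l | 0 < β l}) =>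
        spectralSup (fun n => lawUS (P l n) (V n))) l₀ hl₀)
  obtain ⟨a₁, a₂, h1, h2, ha₂, hlt⟩ := exists_reals_of_lt_sub hnn hrV
  refine absurd (le_capacity_of_eventually_exists_code _ _ hr0 fun ε hε =>
    eventually_exists_code α β hα hβ W hW P hP V hr0 ha₂ hlt (fun k l hk hl => ?_)
      (fun l hl => ?_) hε) (not_le.2 hr)
  · exact tendsto_of_lt_spectralInf (h1.trans_le (iInf₂_le (k, l) ⟨hk, hl⟩))
  · exact tendsto_of_spectralSup_lt ((le_iSup₂ (f := fun l (_ : l ∈ {l | 0 < β l}) =>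
        spectralSup (fun n => lawUS (P l n) (V n))) l hl).trans_lt h2)

end Direct

/-! ### Converse part -/

section Converse

variable {𝒮 : Type u} {𝒳 : Type v} {𝒴 : Type w} {𝒰 : Type z}
  [MeasurableSpace 𝒮] [MeasurableSpace 𝒳] [MeasurableSpace 𝒴] [MeasurableSpace 𝒰]

attribute [instance] Code.markov_encoder

/-- The Verdú-Han bound: taking the message as the auxiliary variable, the probability of a small
information density is controlled by the error probability of the code. -/
theorem exists_testChannel_of_code {M : ℕ} (hM : 0 < M) (C : Code 𝒮 𝒳 𝒴 M) (enc : Fin M → 𝒰)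
    {dec : 𝒰 → Fin M} (hdec : Measurable dec) (hinv : ∀ m, dec (enc m) = m) :
    ∃ V : TestChannel 𝒮 𝒳 𝒰,
      (∀ (P : Measure 𝒮) [IsProbabilityMeasure P], prodMarginals (lawUS P V) = lawUS P V) ∧
      ∀ (P : Measure 𝒮) [IsProbabilityMeasure P] (W : Kernel (𝒳 × 𝒮) 𝒴) [IsMarkovKernel W]
        (t : ℝ), lawUY P V W {p | infoDensity (lawUY P V W) p ≤ t} ≤
          C.avgError W P + ENNReal.ofReal (Real.exp t) * (M : ℝ≥0∞)⁻¹ := by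
  set ν : Measure 𝒰 := (M : ℝ≥0∞)⁻¹ • ∑ m : Fin M, Measure.dirac (enc m) with hν_def
  have hν : ∀ {f : 𝒰 → ℝ≥0∞}, Measurable f →
      ∫⁻ u, f u ∂ν = (M : ℝ≥0∞)⁻¹ * ∑ m : Fin M, f (enc m) := by
    intro f hf
    rw [hν_def, lintegral_smul_measure, lintegral_finsetSum_measure, smul_eq_mul]
    simp_rw [lintegral_dirac' _ hf]
  have hνp : IsProbabilityMeasure ν := by
    constructor
    rw [← lintegral_one, hν measurable_const]
    simp [ENNReal.inv_mul_cancel (Nat.cast_ne_zero.2 hM.ne') (ENNReal.natCast_ne_top M)]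
  have hmeas : Measurable fun p : 𝒮 × 𝒰 => C.encoder (dec p.2) p.1 :=
    (measurable_from_prod_countable_left (f := fun p : 𝒮 × Fin M => C.encoder p.2 p.1)
      fun m => (C.encoder m).measurable).comp (measurable_fst.prodMk (hdec.comp measurable_snd))
  let κ : Kernel (𝒮 × 𝒰) 𝒳 := ⟨fun p => C.encoder (dec p.2) p.1, hmeas⟩
  have hκ : IsMarkovKernel κ :=
    ⟨fun p => inferInstanceAs (IsProbabilityMeasure (C.encoder (dec p.2) p.1))⟩
  let V : TestChannel 𝒮 𝒳 𝒰 := ⟨Kernel.const 𝒮 ν, κ, inferInstance, hκ⟩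
  have hUS : ∀ (P : Measure 𝒮) [IsProbabilityMeasure P], lawUS P V = ν.prod P := by
    intro P _
    ext E hE
    rw [lawUS_apply P V hE, Measure.prod_apply_symm hE]
    rfl
  refine ⟨V, fun P _ => ?_, fun P _ W _ t => ?_⟩
  · rw [prodMarginals, hUS P, Measure.fst_prod, Measure.snd_prod]
  · set ρ := lawUY P V W
    have hfst : ρ.fst = ν := by rw [fst_lawUY, hUS P, Measure.fst_prod]
    have hD : MeasurableSet {p : 𝒰 × 𝒴 | C.decoder p.2 = dec p.1} :=
      measurableSet_eq_fun (C.measurable_decoder.comp measurable_snd) (hdec.comp measurable_fst)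
    -- Under the joint law, disagreement of decoder and message is exactly a decoding error; under
    -- the product of the marginals, agreement has probability at most 1/M.
    have herr : ρ {p : 𝒰 × 𝒴 | C.decoder p.2 = dec p.1}ᶜ = C.avgError W P := by
      have hmE : ∀ m, MeasurableSet {y | C.decoder y ≠ m} := fun m =>
        (C.measurable_decoder (measurableSet_singleton m)).compl
      have hin : ∀ s, ∫⁻ u, V.outKernel W (s, u) {y | (u, y) ∈ {p : 𝒰 × 𝒴 |
          C.decoder p.2 = dec p.1}ᶜ} ∂ν =
          (M : ℝ≥0∞)⁻¹ * ∑ m : Fin M, ∫⁻ x, W (x, s) {y | C.decoder y ≠ m} ∂C.encoder m s := by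
        intro s
        refine (hν ((measurable_outKernel_slice V W hD.compl).comp
          (measurable_prodMk_right (y := s)))).trans ?_
        congr 1
        refine Finset.sum_congr rfl fun m _ => ?_
        have h1 : {y | (enc m, y) ∈ {p : 𝒰 × 𝒴 | C.decoder p.2 = dec p.1}ᶜ} =
            {y | C.decoder y ≠ m} := by
          ext y
          simp [hinv]
        dsimp only [Function.comp]
        rw [h1, outKernel_apply _ _ _ (hmE m)]
        change ∫⁻ x, W (x, s) {y | C.decoder y ≠ m} ∂C.encoder (dec (enc m)) s = _
        rw [hinv]
      rw [lawUY_apply P V W hD.compl, Code.avgError, ← lintegral_const_mul' _ _ (by simpa using hM.ne')]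
      exact lintegral_congr hin
    have hcor : prodMarginals ρ {p : 𝒰 × 𝒴 | C.decoder p.2 = dec p.1} ≤ (M : ℝ≥0∞)⁻¹ := by
      rw [prodMarginals, Measure.prod_apply_symm hD, hfst]
      refine (lintegral_mono (g := fun _ => (M : ℝ≥0∞)⁻¹) fun y => ?_).trans_eq (by simp)
      have hy : MeasurableSet {u | C.decoder y = dec u} :=
        measurableSet_eq_fun measurable_const hdec
      change ν {u | C.decoder y = dec u} ≤ _
      rw [← lintegral_indicator_one hy, hν (measurable_one.indicator hy)]
      simp [Set.indicator_apply, hinv]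
    have hI := measurableSet_infoDensity_le ρ t
    calc ρ {p | infoDensity ρ p ≤ t}
        ≤ ρ {p : 𝒰 × 𝒴 | C.decoder p.2 = dec p.1}ᶜ +
          ρ ({p | infoDensity ρ p ≤ t} ∩ {p : 𝒰 × 𝒴 | C.decoder p.2 = dec p.1}) := by
          refine (measure_mono fun p hp => ?_).trans (measure_union_le _ _)
          by_cases h : p ∈ {p : 𝒰 × 𝒴 | C.decoder p.2 = dec p.1}
          · exact Or.inr ⟨hp, h⟩
          · exact Or.inl h
      _ ≤ _ := by
          rw [herr]
          refine add_le_add_right ((measure_le_of_infoDensity_le ρ fun p hp => hp.1).trans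
            (mul_le_mul_right ((measure_mono Set.inter_subset_right).trans hcor) _)) _

/-- The mixed channel and the mixed state dominate each weighted component, and the error is
monotone in both. -/
theorem mul_avgError_le {M : ℕ} (C : Code 𝒮 𝒳 𝒴 M) (α β : ℕ → ℝ≥0)
    (W : ℕ → Kernel (𝒳 × 𝒮) 𝒴) (P : ℕ → Measure 𝒮) (k l : ℕ) :
    (β l * α k : ℝ≥0∞) * C.avgError (W k) (P l) ≤
      C.avgError (mixKernel α W) (Measure.sum fun l => β l • P l) := by
  have h1 : ∀ (p : 𝒳 × 𝒮) (E : Set 𝒴), (α k : ℝ≥0∞) * W k p E ≤ mixKernel α W p E := fun p E =>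
    (Measure.nnreal_smul_coe_apply _ _ _).symm.trans_le
      (Measure.le_sum (fun k => α k • W k p) k E)
  rw [Code.avgError, Code.avgError, lintegral_sum_smul]
  calc (β l * α k : ℝ≥0∞) * ((M : ℝ≥0∞)⁻¹ *
        ∫⁻ s, ∑ m, ∫⁻ x, W k (x, s) {y | C.decoder y ≠ m} ∂C.encoder m s ∂P l)
      = (M : ℝ≥0∞)⁻¹ * (β l * ∫⁻ s, ∑ m, ∫⁻ x, α k * W k (x, s) {y | C.decoder y ≠ m}
          ∂C.encoder m s ∂P l) := by
        simp_rw [lintegral_const_mul' (α k : ℝ≥0∞) _ ENNReal.coe_ne_top, ← Finset.mul_sum]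
        rw [lintegral_const_mul' (α k : ℝ≥0∞) _ ENNReal.coe_ne_top]
        ring
    _ ≤ (M : ℝ≥0∞)⁻¹ * (β l * ∫⁻ s, ∑ m, ∫⁻ x, mixKernel α W (x, s) {y | C.decoder y ≠ m}
          ∂C.encoder m s ∂P l) := by
        gcongr
        exact h1 _ _
    _ ≤ _ := by
        gcongr
        exact ENNReal.le_tsum (f := fun l => (β l : ℝ≥0∞) * ∫⁻ s, ∑ m, ∫⁻ x,
          mixKernel α W (x, s) {y | C.decoder y ≠ m} ∂C.encoder m s ∂P l) l

theorem eventually_exists_code_of_lt_capacity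
    (W : ∀ n, Kernel ((Fin n → 𝒳) × (Fin n → 𝒮)) (Fin n → 𝒴)) (P : ∀ n, Measure (Fin n → 𝒮))
    {r : ℝ} (hr : (r : EReal) < capacity W P) {ε : ℝ≥0∞} (hε : 0 < ε) :
    ∀ᶠ n : ℕ in atTop, ∃ (M : ℕ) (C : Code (Fin n → 𝒮) (Fin n → 𝒳) (Fin n → 𝒴) M),
      Real.exp (n * r) ≤ M ∧ C.avgError (W n) (P n) ≤ ε := by
  obtain ⟨ε', hε', hεε'⟩ := exists_between hε
  have hcap : capacity W P ≤ epsCapacity W P ε' := by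
    refine le_of_tendsto (tendsto_epsCapacity W P) ?_
    filter_upwards [Ioo_mem_nhdsGT hε'] with e he
    exact epsCapacity_mono W P he.2.le
  obtain ⟨_, ⟨R, ⟨_, M, e, hM, hC, hlim, hsup⟩, rfl⟩, hrR⟩ := lt_sSup_iff.1 (hr.trans_le hcap)
  filter_upwards [eventually_lt_of_limsup_lt (hsup.trans_lt hεε'),
    eventually_lt_of_lt_liminf (hrR.trans_le hlim), eventually_gt_atTop 0] with n h1 h2 hn
  obtain ⟨C, hCe⟩ := hC n
  refine ⟨M n, C, ?_, hCe.trans h1.le⟩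
  have h2 : r < Real.log (M n) / n := by exact_mod_cast h2
  rw [lt_div_iff₀ (by exact_mod_cast hn), Real.lt_log_iff_exp_lt (by exact_mod_cast hM n),
    mul_comm] at h2
  exact h2.le

/-- The definition of capacity gives a different sequence of codes for each error level. A single
sequence arises by taking, for each `n`, a nearly optimal code among those with at least exp(nr)
messages. -/
theorem exists_codes_tendsto [Nonempty 𝒳]
    (W : ∀ n, Kernel ((Fin n → 𝒳) × (Fin n → 𝒮)) (Fin n → 𝒴)) (P : ∀ n, Measure (Fin n → 𝒮))
    {r : ℝ} (hr : (r : EReal) < capacity W P) :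
    ∃ (M : ℕ → ℕ) (C : ∀ n, Code (Fin n → 𝒮) (Fin n → 𝒳) (Fin n → 𝒴) (M n)),
      (∀ n : ℕ, Real.exp (n * r) ≤ M n) ∧
      Tendsto (fun n => (C n).avgError (W n) (P n)) atTop (𝓝 0) := by
  set S : ℕ → Set ℝ≥0∞ := fun n => {e | ∃ (M : ℕ)
    (C : Code (Fin n → 𝒮) (Fin n → 𝒳) (Fin n → 𝒴) M),
      Real.exp (n * r) ≤ M ∧ C.avgError (W n) (P n) = e}
  have hS : ∀ n, (S n).Nonempty := fun n => by
    have : NeZero ⌈Real.exp (n * r)⌉₊ := ⟨(Nat.ceil_pos.2 (Real.exp_pos _)).ne'⟩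
    exact ⟨_, ⌈Real.exp (n * r)⌉₊, Classical.arbitrary _, Nat.le_ceil _, rfl⟩
  have hex : ∀ n : ℕ, ∃ (M : ℕ) (C : Code (Fin n → 𝒮) (Fin n → 𝒳) (Fin n → 𝒴) M),
      Real.exp (n * r) ≤ M ∧ C.avgError (W n) (P n) ≤ sInf (S n) + (n : ℝ≥0∞)⁻¹ := by
    intro n
    by_cases htop : sInf (S n) = ⊤
    · obtain ⟨_, M, C, h1, _⟩ := hS n
      exact ⟨M, C, h1, by rw [htop, top_add]; exact le_top⟩
    · obtain ⟨_, ⟨M, C, h1, rfl⟩, h2⟩ := sInf_lt_iff.1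
        (ENNReal.lt_add_right htop (ENNReal.inv_ne_zero.2 (ENNReal.natCast_ne_top n)))
      exact ⟨M, C, h1, h2.le⟩
  choose M C hM hC using hex
  refine ⟨M, C, hM, ?_⟩
  have h0 : Tendsto (fun n => sInf (S n)) atTop (𝓝 0) := by
    refine ENNReal.tendsto_nhds_zero.2 fun ε hε => ?_
    filter_upwards [eventually_exists_code_of_lt_capacity W P hr hε] with n ⟨M, C, h1, h2⟩
    exact (sInf_le (show _ ∈ S n from ⟨M, C, h1, rfl⟩)).trans h2
  have h1 := h0.add ENNReal.tendsto_inv_nat_nhds_zero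
  rw [add_zero] at h1
  exact tendsto_of_tendsto_of_tendsto_of_le_of_le tendsto_const_nhds h1 (fun _ => zero_le) hC

/-- For independent pairs, the event E of density above na satisfies exp(na) ρ(E) ≤ ρ(E), so ρ(E) =
0 for a > 0. Length 0 is exempt because `Fin 0 → 𝒰` has one point and cannot carry a message. -/
theorem spectralSup_nonpos_of_prodMarginals_eq {A B : ℕ → Type*} [∀ n, MeasurableSpace (A n)]
    [∀ n, MeasurableSpace (B n)] (ρ : ∀ n, Measure (A n × B n)) [∀ n, IsProbabilityMeasure (ρ n)]
    (h : ∀ n, 0 < n → prodMarginals (ρ n) = ρ n) : spectralSup ρ ≤ 0 := by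
  have key : ∀ a : ℝ, 0 < a → spectralSup ρ ≤ (a : EReal) := by
    intro a ha
    refine spectralSup_le_of_tendsto (tendsto_const_nhds.congr' ?_)
    filter_upwards [eventually_gt_atTop 0] with n hn
    by_contra hne
    have h1 := le_measure_of_le_infoDensity (ρ n)
      (E := {p | ((n * a : ℝ) : EReal) < infoDensity (ρ n) p}) fun p hp => le_of_lt hp
    rw [h n hn] at h1
    have hlt : (1 : ℝ≥0∞) < ENNReal.ofReal (Real.exp (n * a)) := by
      rw [ENNReal.one_lt_ofReal]
      exact Real.one_lt_exp_iff.2 (by positivity)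
    have h2 := ENNReal.mul_lt_mul_left (Ne.symm hne) (measure_ne_top _ _) hlt
    rw [one_mul] at h2
    exact absurd h1 (not_le.2 h2)
  refine le_of_forall_gt_imp_ge_of_dense fun b hb => ?_
  obtain ⟨a, ha, hab⟩ := EReal.lt_iff_exists_real_btwn.1 hb
  exact (key a (by exact_mod_cast ha)).trans hab.le

theorem exists_le_spectralValue [Nonempty 𝒳] (α β : ℕ → ℝ≥0)
    (W : ℕ → ∀ n, Kernel ((Fin n → 𝒳) × (Fin n → 𝒮)) (Fin n → 𝒴))
    (hW : ∀ k n, IsMarkovKernel (W k n))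
    (P : ℕ → ∀ n, Measure (Fin n → 𝒮)) (hP : ∀ l n, IsProbabilityMeasure (P l n))
    (up : ℕ → 𝒰) {down : 𝒰 → ℕ} (hdown : Measurable down) (hinv : ∀ k, down (up k) = k)
    {r : ℝ} (hr : (r : EReal) < capacity (mixChannel α W) (mixState β P)) :
    ∃ V : ∀ n, TestChannel (Fin n → 𝒮) (Fin n → 𝒳) (Fin n → 𝒰),
      (r : EReal) ≤ spectralValue α β W P V := by
  obtain ⟨r', hrr', hr'⟩ := EReal.lt_iff_exists_real_btwn.1 hr
  have hrr' : r < r' := by exact_mod_cast hrr'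
  obtain ⟨M, C, hM, hC⟩ := exists_codes_tendsto (mixChannel α W) (mixState β P) hr'
  have hM0 : ∀ n, 0 < M n := fun n => by
    exact_mod_cast (Real.exp_pos _).trans_le (hM n)
  have hV : ∀ n, ∃ V : TestChannel (Fin n → 𝒮) (Fin n → 𝒳) (Fin n → 𝒰), 0 < n →
      (∀ (P : Measure (Fin n → 𝒮)) [IsProbabilityMeasure P],
        prodMarginals (lawUS P V) = lawUS P V) ∧
      ∀ (P : Measure (Fin n → 𝒮)) [IsProbabilityMeasure P]
        (W : Kernel ((Fin n → 𝒳) × (Fin n → 𝒮)) (Fin n → 𝒴)) [IsMarkovKernel W]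
        (t : ℝ), lawUY P V W {p | infoDensity (lawUY P V W) p ≤ t} ≤
          (C n).avgError W P + ENNReal.ofReal (Real.exp t) * (M n : ℝ≥0∞)⁻¹ := by
    intro n
    have : NeZero (M n) := ⟨(hM0 n).ne'⟩
    rcases Nat.eq_zero_or_pos n with h0 | hn
    · exact ⟨⟨Kernel.const _ (Measure.dirac fun _ => up 0), Kernel.const _ (Measure.dirac fun _ =>
        Classical.arbitrary 𝒳), inferInstance, inferInstance⟩, fun h => absurd h0 h.ne'⟩
    · obtain ⟨V, hV⟩ := exists_testChannel_of_code (hM0 n) (C n)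
        -- The auxiliary variable must be a word of length `n`, so the message is repeated in all
        -- coordinates and read off the first; `Fin.ofNat` reduces modulo `M n` to make the reading
        -- total.
        (enc := fun m (_ : Fin n) => up m)
        (dec := fun u => Fin.ofNat (M n) (down (u ⟨0, hn⟩)))
        ((measurable_of_countable (Fin.ofNat (M n))).comp
          (hdown.comp (measurable_pi_apply _))) fun m => by simp [hinv]
      exact ⟨V, fun _ => hV⟩
  choose V hV using hV
  refine ⟨V, ?_⟩
  have h1 : (r : EReal) ≤ ⨅ q ∈ {k | 0 < α k} ×ˢ {l | 0 < β l},
      spectralInf (fun n => lawUY (P q.2 n) (V n) (W q.1 n)) := by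
    refine le_iInf₂ fun q hq => le_spectralInf_of_tendsto ?_
    obtain ⟨k, l⟩ := q
    have hk : (α k : ℝ≥0∞) ≠ 0 := by simpa using (ne_of_gt hq.1 : α k ≠ 0)
    have hl : (β l : ℝ≥0∞) ≠ 0 := by simpa using (ne_of_gt hq.2 : β l ≠ 0)
    have h2 : Tendsto (fun n => (β l * α k : ℝ≥0∞)⁻¹ *
        (C n).avgError (mixChannel α W n) (mixState β P n) +
        ENNReal.ofReal (Real.exp (-(n * (r' - r))))) atTop (𝓝 0) := by
      have := (ENNReal.Tendsto.const_mul (a := (β l * α k : ℝ≥0∞)⁻¹) hC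
        (Or.inr (ENNReal.inv_ne_top.2 (mul_ne_zero hl hk)))).add
        (tendsto_ofReal_exp_neg (sub_pos.2 hrr'))
      rwa [mul_zero, add_zero] at this
    refine tendsto_of_tendsto_of_tendsto_of_le_of_le' tendsto_const_nhds h2
      (Eventually.of_forall fun _ => zero_le) ?_
    filter_upwards [eventually_gt_atTop 0] with n hn
    refine ((hV n hn).2 (P l n) (W k n) (n * r)).trans (add_le_add ?_ ?_)
    · rw [mul_comm, ← div_eq_mul_inv, ENNReal.le_div_iff_mul_le (Or.inl (mul_ne_zero hl hk))
        (Or.inl (by finiteness)), mul_comm]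
      exact mul_avgError_le (C n) α β (fun k => W k n) (fun l => P l n) k l
    · have hMpos : (0 : ℝ) < M n := by exact_mod_cast hM0 n
      rw [← ENNReal.ofReal_natCast, ← ENNReal.ofReal_inv_of_pos hMpos,
        ← ENNReal.ofReal_mul (Real.exp_pos _).le]
      refine ENNReal.ofReal_le_ofReal ?_
      rw [← div_eq_mul_inv, div_le_iff₀ hMpos]
      calc Real.exp (n * r) = Real.exp (-(n * (r' - r))) * Real.exp (n * r') := by
            rw [← Real.exp_add]; ring_nf
        _ ≤ _ := by gcongr; exact hM n
  have h2 : ⨆ l ∈ {l | 0 < β l}, spectralSup (fun n => lawUS (P l n) (V n)) ≤ 0 :=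
    iSup₂_le fun l _ => spectralSup_nonpos_of_prodMarginals_eq _ fun n hn => (hV n hn).1 (P l n)
  have h3 := EReal.sub_le_sub h1 h2
  rwa [sub_zero] at h3

theorem capacity_le_iSup_spectralValue [Nonempty 𝒳] (α β : ℕ → ℝ≥0)
    (W : ℕ → ∀ n, Kernel ((Fin n → 𝒳) × (Fin n → 𝒮)) (Fin n → 𝒴))
    (hW : ∀ k n, IsMarkovKernel (W k n))
    (P : ℕ → ∀ n, Measure (Fin n → 𝒮)) (hP : ∀ l n, IsProbabilityMeasure (P l n)) :
    capacity (mixChannel α W) (mixState β P) ≤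
      ⨆ (𝒰 : Type z) (_ : MeasurableSpace 𝒰)
        (V : ∀ n, TestChannel (Fin n → 𝒮) (Fin n → 𝒳) (Fin n → 𝒰)),
        spectralValue α β W P V := by
  refine le_of_forall_lt_imp_le_of_dense fun b hb => ?_
  obtain ⟨r, hbr, hr⟩ := EReal.lt_iff_exists_real_btwn.1 hb
  -- One countable alphabet holds the messages of all lengths; the lift places it in the universe of
  -- the supremum.
  let _ : MeasurableSpace (ULift.{z} ℕ) := ⊤
  obtain ⟨V, hV⟩ := exists_le_spectralValue (𝒰 := ULift.{z} ℕ) α β W hW P hP ULift.up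
    (down := ULift.down) measurable_from_top (fun _ => rfl) hr
  exact hbr.le.trans (hV.trans (le_iSup_of_le (ULift.{z} ℕ) (le_iSup_of_le ⊤ (le_iSup_of_le V
    le_rfl))))

end Converse

/-! ### Law of large numbers and densities for product measures -/

section LawOfLargeNumbers

theorem infinitePi_map_fin {Z : Type*} [MeasurableSpace Z] (ρ : Measure Z) [IsProbabilityMeasure ρ]
    (n : ℕ) : (Measure.infinitePi fun _ : ℕ => ρ).map (fun ω (i : Fin n) => ω i) =
      Measure.pi fun _ : Fin n => ρ := by
  rw [Measure.map_infinitePi_infinitePi_of_inj (P := fun _ : ℕ => ρ) Fin.val_injective,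
    Measure.infinitePi_eq_pi]

/-- The weak law of large numbers for product measures. -/
theorem tendsto_pi_sum_le {Z : Type*} [MeasurableSpace Z] (ρ : Measure Z) [IsProbabilityMeasure ρ]
    {g : Z → ℝ} (hg : Measurable g) (hint : Integrable g ρ) {m : ℝ} (hm : m < ∫ z, g z ∂ρ) :
    Tendsto (fun n : ℕ => Measure.pi (fun _ : Fin n => ρ) {z | ∑ i, g (z i) ≤ n * m})
      atTop (𝓝 0) := by
  set μ := Measure.infinitePi fun _ : ℕ => ρ
  have hev : ∀ i : ℕ, MeasurePreserving (fun ω : ℕ → Z => ω i) μ ρ := fun i =>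
    measurePreserving_eval_infinitePi (fun _ : ℕ => ρ) i
  have hX0 : ∫ ω, g (ω 0) ∂μ = ∫ z, g z ∂ρ := by
    rw [← (hev 0).map_eq, integral_map (hev 0).measurable.aemeasurable hg.aestronglyMeasurable]
  have hlaw := strong_law_ae_real (μ := μ) (fun (i : ℕ) (ω : ℕ → Z) => g (ω i))
    ((hev 0).integrable_comp_of_integrable hint)
    (fun i j hij => (iIndepFun_infinitePi (P := fun _ : ℕ => ρ) (X := fun _ => g)
      fun _ => hg).indepFun hij)
    (fun i => ⟨(hg.comp (measurable_pi_apply i)).aemeasurable,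
      (hg.comp (measurable_pi_apply 0)).aemeasurable, by
        have h1 : ∀ j : ℕ, μ.map (fun ω => g (ω j)) = ρ.map g := fun j => by
          rw [← (hev j).map_eq, Measure.map_map hg (measurable_pi_apply j)]
          rfl
        rw [h1, h1]⟩)
  rw [hX0] at hlaw
  -- The strong law on the infinite product gives convergence in measure, a statement on the first
  -- `n` coordinates for each `n`.
  have hmeas := tendstoInMeasure_of_tendsto_ae (μ := μ)
    (f := fun (n : ℕ) (ω : ℕ → Z) => (∑ i ∈ Finset.range n, g (ω i)) / n)
    (fun n => Measurable.aestronglyMeasurable (by fun_prop)) hlaw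
  have hpos : 0 < ∫ z, g z ∂ρ - m := sub_pos.2 hm
  have h2 := hmeas (ENNReal.ofReal (∫ z, g z ∂ρ - m)) (ENNReal.ofReal_pos.2 hpos)
  refine tendsto_of_tendsto_of_tendsto_of_le_of_le' tendsto_const_nhds h2
    (Eventually.of_forall fun _ => zero_le) ?_
  filter_upwards [eventually_gt_atTop 0] with n hn
  have hn' : (0 : ℝ) < n := by exact_mod_cast hn
  rw [← infinitePi_map_fin ρ n, Measure.map_apply (by fun_prop)
    (measurableSet_le (by fun_prop) measurable_const)]
  refine measure_mono fun ω hω => ?_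
  have h3 : ∑ i : Fin n, g (ω i) ≤ n * m := hω
  rw [Fin.sum_univ_eq_sum_range (fun i => g (ω i))] at h3
  change ENNReal.ofReal _ ≤ edist _ _
  rw [edist_comm, edist_dist, Real.dist_eq]
  refine ENNReal.ofReal_le_ofReal (le_trans ?_ (le_abs_self _))
  have h4 : (∑ i ∈ Finset.range n, g (ω i)) / n ≤ m := by
    rw [div_le_iff₀ hn']
    linarith
  linarith

theorem lintegral_pi_prod {ι : Type*} [Fintype ι] {Z : ι → Type*} [∀ i, MeasurableSpace (Z i)]
    (μ : ∀ i, Measure (Z i)) [∀ i, IsProbabilityMeasure (μ i)] {f : ∀ i, Z i → ℝ≥0∞}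
    (hf : ∀ i, Measurable (f i)) :
    ∫⁻ z, ∏ i, f i (z i) ∂Measure.pi μ = ∏ i, ∫⁻ x, f i x ∂μ i := by
  have hind : iIndepFun (fun i (z : ∀ i, Z i) => f i (z i)) (Measure.pi μ) :=
    iIndepFun_pi fun i => (hf i).aemeasurable
  rw [lintegral_prod_eq_prod_lintegral_of_indepFun _ _ hind
    fun i => (hf i).comp (measurable_pi_apply i)]
  exact Finset.prod_congr rfl fun i _ => (measurePreserving_eval μ i).lintegral_comp (hf i)

theorem withDensity_pi {Z : Type*} [MeasurableSpace Z] (ρ : Measure Z) [IsProbabilityMeasure ρ]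
    {f : Z → ℝ≥0∞} (hf : Measurable f) (ν : Measure Z) [IsFiniteMeasure ν]
    (h : ρ.withDensity f = ν) (n : ℕ) :
    (Measure.pi fun _ : Fin n => ρ).withDensity (fun z => ∏ i, f (z i)) =
      Measure.pi fun _ : Fin n => ν := by
  symm
  refine Measure.pi_eq fun s hs => ?_
  rw [withDensity_apply _ (MeasurableSet.univ_pi hs), ← lintegral_indicator
    (MeasurableSet.univ_pi hs)]
  have h1 : ∀ z : Fin n → Z, (Set.univ.pi s).indicator (fun z => ∏ i, f (z i)) z =
      ∏ i, (s i).indicator f (z i) := by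
    intro z
    by_cases hz : z ∈ Set.univ.pi s
    · rw [Set.indicator_of_mem hz]
      exact Finset.prod_congr rfl fun i _ => (Set.indicator_of_mem (hz i trivial) _).symm
    · rw [Set.indicator_of_notMem hz]
      simp only [Set.mem_pi, Set.mem_univ, true_implies, not_forall] at hz
      obtain ⟨i, hi⟩ := hz
      exact (Finset.prod_eq_zero (Finset.mem_univ i) (Set.indicator_of_notMem hi _)).symm
  simp_rw [h1]
  rw [lintegral_pi_prod (fun _ : Fin n => ρ) fun i => hf.indicator (hs i)]
  refine Finset.prod_congr rfl fun i _ => ?_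
  rw [lintegral_indicator (hs i), ← withDensity_apply _ (hs i), h]

end LawOfLargeNumbers

/-! ### Spectral rates of i.i.d. pairs and mutual information -/

section Memoryless

variable {A B : Type*} [MeasurableSpace A] [MeasurableSpace B]

/-- The law of `n` independent copies of a pair. -/
noncomputable def iidPairs (ρ : Measure (A × B)) (n : ℕ) : Measure ((Fin n → A) × (Fin n → B)) :=
  (Measure.pi fun _ : Fin n => ρ).map (MeasurableEquiv.arrowProdEquivProdArrow A B (Fin n))

instance (ρ : Measure (A × B)) [IsProbabilityMeasure ρ] (n : ℕ) :
    IsProbabilityMeasure (iidPairs ρ n) :=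
  Measure.isProbabilityMeasure_map (MeasurableEquiv.measurable _).aemeasurable

theorem iidPairs_apply (ρ : Measure (A × B)) (n : ℕ) (E : Set ((Fin n → A) × (Fin n → B))) :
    iidPairs ρ n E = Measure.pi (fun _ : Fin n => ρ)
      (MeasurableEquiv.arrowProdEquivProdArrow A B (Fin n) ⁻¹' E) :=
  MeasurableEquiv.map_apply _ _

theorem prodMarginals_iidPairs (ρ : Measure (A × B)) [IsProbabilityMeasure ρ] (n : ℕ) :
    prodMarginals (iidPairs ρ n) = iidPairs (prodMarginals ρ) n := by
  have h1 : (iidPairs ρ n).fst = Measure.pi fun _ : Fin n => ρ.fst := by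
    rw [Measure.fst, iidPairs, Measure.map_map measurable_fst (MeasurableEquiv.measurable _)]
    exact Measure.pi_map_pi fun _ => measurable_fst.aemeasurable
  have h2 : (iidPairs ρ n).snd = Measure.pi fun _ : Fin n => ρ.snd := by
    rw [Measure.snd, iidPairs, Measure.map_map measurable_snd (MeasurableEquiv.measurable _)]
    exact Measure.pi_map_pi fun _ => measurable_snd.aemeasurable
  rw [prodMarginals, h1, h2, iidPairs]
  exact (measurePreserving_arrowProdEquivProdArrow A B (Fin n) (fun _ => ρ.fst)
    (fun _ => ρ.snd)).map_eq.symm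

/-- A lower bound on the spectral inf-information rate of i.i.d. pairs in terms of a test function
`h` whose mean under the product of the marginals is at most one. -/
theorem le_spectralInf_iidPairs (ρ : Measure (A × B)) [IsProbabilityMeasure ρ] {h : A × B → ℝ}
    (hm : Measurable h) (hpos : ∀ᵐ p ∂ρ, 0 < h p)
    (hle : ∫⁻ p, ENNReal.ofReal (h p) ∂prodMarginals ρ ≤ 1)
    (hint : Integrable (fun p => Real.log (h p)) ρ) {a : ℝ} (ha : a < ∫ p, Real.log (h p) ∂ρ) :
    (a : EReal) ≤ spectralInf (iidPairs ρ) := by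
  obtain ⟨a', haa', ha'⟩ := exists_between ha
  refine le_spectralInf_of_tendsto ?_
  have hlim := (tendsto_ofReal_exp_neg (sub_pos.2 haa')).add
    (tendsto_pi_sum_le ρ (Real.measurable_log.comp hm) hint ha')
  rw [add_zero] at hlim
  refine tendsto_of_tendsto_of_tendsto_of_le_of_le tendsto_const_nhds hlim (fun _ => zero_le)
    fun n => ?_
  set φ := MeasurableEquiv.arrowProdEquivProdArrow A B (Fin n)
  set I := {p | infoDensity (iidPairs ρ n) p ≤ ((n * a : ℝ) : EReal)}
  set H : Set (Fin n → A × B) :=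
    {z | ENNReal.ofReal (Real.exp (n * a')) ≤ ∏ i, ENNReal.ofReal (h (z i))}
  have hHm : MeasurableSet H := measurableSet_le measurable_const (by fun_prop)
  -- Under the product of the marginals ∏ h has mean at most 1, so `H` has probability at most
  -- exp(-na') by Markov's inequality; the small density on `I` costs a factor exp(na). Off `H` the
  -- law of large numbers takes over.
  have h1 : iidPairs ρ n (I ∩ φ.symm ⁻¹' H) ≤ ENNReal.ofReal (Real.exp (-(n * (a' - a)))) := by
    have h2 : prodMarginals (iidPairs ρ n) (I ∩ φ.symm ⁻¹' H) ≤
        ENNReal.ofReal (Real.exp (-(n * a'))) := by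
      rw [prodMarginals_iidPairs, iidPairs_apply]
      refine (measure_mono (t := H) fun z hz => ?_).trans ?_
      · have h3 : φ.symm (φ z) ∈ H := hz.2
        rwa [φ.symm_apply_apply] at h3
      · refine (meas_ge_le_lintegral_div (Measurable.aemeasurable (by fun_prop)) (by simp [Real.exp_pos])
          ENNReal.ofReal_ne_top).trans ?_
        rw [lintegral_pi_prod (fun _ : Fin n => prodMarginals ρ)
          (f := fun _ p => ENNReal.ofReal (h p)) fun _ => by fun_prop, Real.exp_neg,
          ENNReal.ofReal_inv_of_pos (Real.exp_pos _), ENNReal.div_eq_inv_mul]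
        exact mul_le_of_le_one_right zero_le (Finset.prod_le_one' fun _ _ => hle)
    refine (measure_le_of_infoDensity_le _ fun p hp => hp.1).trans
      ((mul_le_mul_right h2 _).trans_eq ?_)
    rw [← ENNReal.ofReal_mul (Real.exp_pos _).le, ← Real.exp_add]
    ring_nf
  have hpos' : ∀ᵐ z ∂Measure.pi (fun _ : Fin n => ρ), ∀ i, 0 < h (z i) :=
    ae_all_iff.2 fun i =>
      (measurePreserving_eval (fun _ : Fin n => ρ) i).quasiMeasurePreserving.ae hpos
  have h3 : iidPairs ρ n (φ.symm ⁻¹' Hᶜ) ≤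
      Measure.pi (fun _ : Fin n => ρ) {z | ∑ i, Real.log (h (z i)) ≤ n * a'} := by
    rw [iidPairs_apply]
    refine measure_mono_ae ?_
    filter_upwards [hpos'] with z hz hzH
    have hzH : φ.symm (φ z) ∉ H := hzH
    rw [φ.symm_apply_apply] at hzH
    change ¬ ENNReal.ofReal (Real.exp (n * a')) ≤ ∏ i, ENNReal.ofReal (h (z i)) at hzH
    rw [← ENNReal.ofReal_prod_of_nonneg fun i _ => (hz i).le, not_le,
      ENNReal.ofReal_lt_ofReal_iff (Real.exp_pos _)] at hzH
    have h4 := Real.log_lt_log (Finset.prod_pos fun i _ => hz i) hzH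
    rw [Real.log_exp, Real.log_prod fun i _ => (hz i).ne'] at h4
    exact h4.le
  refine (measure_mono (t := (I ∩ φ.symm ⁻¹' H) ∪ φ.symm ⁻¹' Hᶜ) fun p hp => ?_).trans
    ((measure_union_le _ _).trans (add_le_add h1 h3))
  by_cases hpH : p ∈ φ.symm ⁻¹' H
  · exact Or.inl ⟨hp, hpH⟩
  · exact Or.inr hpH

/-- An upper bound on the spectral sup-information rate of i.i.d. pairs in terms of a version `g` of
the information density. -/
theorem spectralSup_iidPairs_le (ρ : Measure (A × B)) [IsProbabilityMeasure ρ] {g : A × B → ℝ}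
    (hm : Measurable g) (hint : Integrable g ρ) {s : Set (A × B)}
    (hg : ρ.withDensity (fun p => ENNReal.ofReal (Real.exp (-g p))) = (prodMarginals ρ).restrict s)
    {b : ℝ} (hb : ∫ p, g p ∂ρ < b) : spectralSup (iidPairs ρ) ≤ (b : EReal) := by
  obtain ⟨b', hb', hbb'⟩ := exists_between hb
  refine spectralSup_le_of_tendsto ?_
  have hlim := (tendsto_ofReal_exp_neg (sub_pos.2 hbb')).add
    (tendsto_pi_sum_le ρ hm.neg hint.neg (m := -b') (by
      simp only [Pi.neg_apply, integral_neg]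
      linarith))
  rw [add_zero] at hlim
  refine tendsto_of_tendsto_of_tendsto_of_le_of_le tendsto_const_nhds hlim (fun _ => zero_le)
    fun n => ?_
  set φ := MeasurableEquiv.arrowProdEquivProdArrow A B (Fin n)
  set I := {p | ((n * b : ℝ) : EReal) < infoDensity (iidPairs ρ n) p}
  have hI : MeasurableSet I := measurableSet_lt_infoDensity _ _
  have hIm : MeasurableSet (φ ⁻¹' I) := φ.measurable hI
  have h1 : Measure.pi (fun _ : Fin n => prodMarginals ρ) (φ ⁻¹' I) ≤
      ENNReal.ofReal (Real.exp (-(n * b))) := by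
    have h2 := (le_measure_of_le_infoDensity (iidPairs ρ n) (E := I) fun p hp => le_of_lt hp).trans
      prob_le_one
    rw [prodMarginals_iidPairs, iidPairs_apply] at h2
    rw [Real.exp_neg, ENNReal.ofReal_inv_of_pos (Real.exp_pos _), ENNReal.le_inv_iff_mul_le,
      mul_comm]
    exact h2
  -- Where Σ g ≤ nb', the joint law is at most exp(nb') times the law with density exp(-Σ g), which
  -- is dominated by the product of the marginals; that product gives `I` at most exp(-nb).
  have h3 : Measure.pi (fun _ : Fin n => ρ) (φ ⁻¹' I ∩ {z | ∑ i, g (z i) ≤ n * b'}) ≤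
      ENNReal.ofReal (Real.exp (-(n * (b - b')))) := by
    set G : Set (Fin n → A × B) := {z | ∑ i, g (z i) ≤ n * b'}
    have hG : MeasurableSet G := measurableSet_le (by fun_prop) measurable_const
    have h4 := withDensity_pi ρ (f := fun p => ENNReal.ofReal (Real.exp (-g p))) (by fun_prop) _ hg n
    calc Measure.pi (fun _ : Fin n => ρ) (φ ⁻¹' I ∩ G)
        = ENNReal.ofReal (Real.exp (n * b')) * (ENNReal.ofReal (Real.exp (-(n * b'))) *
            Measure.pi (fun _ : Fin n => ρ) (φ ⁻¹' I ∩ G)) := by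
          rw [← mul_assoc, ← ENNReal.ofReal_mul (Real.exp_pos _).le, ← Real.exp_add]
          simp
      _ ≤ ENNReal.ofReal (Real.exp (n * b')) * ∫⁻ z in φ ⁻¹' I,
            ∏ i, ENNReal.ofReal (Real.exp (-g (z i))) ∂Measure.pi (fun _ : Fin n => ρ) := by
          refine mul_le_mul_right ?_ _
          rw [← setLIntegral_const]
          refine (setLIntegral_mono (by fun_prop) fun z hz => ?_).trans
            (lintegral_mono_set Set.inter_subset_left)
          rw [← ENNReal.ofReal_prod_of_nonneg fun i _ => (Real.exp_pos _).le, ← Real.exp_sum,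
            Finset.sum_neg_distrib]
          exact ENNReal.ofReal_le_ofReal (Real.exp_le_exp.2 (neg_le_neg hz.2))
      _ ≤ ENNReal.ofReal (Real.exp (n * b')) *
            Measure.pi (fun _ : Fin n => prodMarginals ρ) (φ ⁻¹' I) := by
          refine mul_le_mul_right ?_ _
          rw [← withDensity_apply _ hIm, h4, ← Measure.restrict_pi_pi]
          exact Measure.restrict_apply_le _ _
      _ ≤ ENNReal.ofReal (Real.exp (n * b')) * ENNReal.ofReal (Real.exp (-(n * b))) :=
          mul_le_mul_right h1 _
      _ = _ := by
          rw [← ENNReal.ofReal_mul (Real.exp_pos _).le, ← Real.exp_add]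
          ring_nf
  rw [iidPairs_apply]
  refine (measure_mono fun z hz => ?_).trans ((measure_union_le _ _).trans
    (add_le_add h3 (le_refl (Measure.pi (fun _ : Fin n => ρ)
      {z | ∑ i, (-g) (z i) ≤ n * -b'}))))
  by_cases hzG : ∑ i, g (z i) ≤ n * b'
  · exact Or.inl ⟨hz, hzG⟩
  · refine Or.inr ?_
    change ∑ i, -g (z i) ≤ n * -b'
    rw [Finset.sum_neg_distrib]
    linarith

theorem toReal_mutualInfo {ρ : Measure (A × B)} [IsProbabilityMeasure ρ]
    (h : mutualInfo ρ ≠ ⊤) : (mutualInfo ρ : EReal) =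
      ((∫ p, llr ρ (prodMarginals ρ) p ∂ρ : ℝ) : EReal) := by
  obtain ⟨hac, _⟩ := InformationTheory.klDiv_ne_top_iff.1 h
  rw [← InformationTheory.toReal_klDiv_of_measure_eq hac (by simp)]
  exact (EReal.coe_ennreal_toReal h).symm

theorem spectralSup_iidPairs_le_mutualInfo (ρ : Measure (A × B)) [IsProbabilityMeasure ρ] :
    spectralSup (iidPairs ρ) ≤ (mutualInfo ρ : EReal) := by
  by_cases htop : mutualInfo ρ = ⊤
  · rw [htop]
    exact le_top
  obtain ⟨hac, hint⟩ := InformationTheory.klDiv_ne_top_iff.1 htop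
  rw [toReal_mutualInfo htop]
  set μ := prodMarginals ρ
  have hf := Measure.measurable_rnDeriv ρ μ
  have hs : MeasurableSet {p | ρ.rnDeriv μ p ≠ 0} := (measurableSet_eq_fun hf measurable_const).compl
  -- Dividing `ρ` by its density recovers `μ` only where the density is nonzero, hence the
  -- restriction.
  have hg : ρ.withDensity (fun p => ENNReal.ofReal (Real.exp (-llr ρ μ p))) =
      μ.restrict {p | ρ.rnDeriv μ p ≠ 0} := by
    have hl : Measurable fun p => ENNReal.ofReal (Real.exp (-llr ρ μ p)) := by
      have := measurable_llr ρ μ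
      fun_prop
    ext E hE
    rw [withDensity_apply _ hE, Measure.restrict_apply hE, ← lintegral_indicator hE,
      ← lintegral_rnDeriv_mul hac (hl.indicator hE).aemeasurable,
      ← lintegral_indicator_one (hE.inter hs)]
    refine lintegral_congr_ae ?_
    filter_upwards [Measure.rnDeriv_lt_top ρ μ] with p hp
    by_cases hpE : p ∈ E
    · by_cases h0 : ρ.rnDeriv μ p = 0
      · simp [h0]
      · have hpos : 0 < (ρ.rnDeriv μ p).toReal := ENNReal.toReal_pos h0 hp.ne
        rw [Set.indicator_of_mem hpE, Set.indicator_of_mem (show p ∈ E ∩ _ from ⟨hpE, h0⟩), llr,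
          Real.exp_neg, Real.exp_log hpos, ENNReal.ofReal_inv_of_pos hpos,
          ENNReal.ofReal_toReal hp.ne, ENNReal.mul_inv_cancel h0 hp.ne]
        rfl
    · simp [hpE]
  refine le_of_forall_gt_imp_ge_of_dense fun c hc => ?_
  obtain ⟨b, hb, hbc⟩ := EReal.lt_iff_exists_real_btwn.1 hc
  exact (spectralSup_iidPairs_le ρ (measurable_llr ρ μ) hint hg (by exact_mod_cast hb)).trans hbc.le

/-- On a `μ`-null set charged by `ρ`, the test function can be made as large as desired without
changing its `μ`-mean. -/
theorem exists_test_of_not_ac {Ω : Type*} [MeasurableSpace Ω] (ρ μ : Measure Ω)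
    [IsProbabilityMeasure ρ] [IsProbabilityMeasure μ] (h : ¬ ρ ≪ μ) (a : ℝ) :
    ∃ f : Ω → ℝ, Measurable f ∧ (∀ᵐ p ∂ρ, 0 < f p) ∧ ∫⁻ p, ENNReal.ofReal (f p) ∂μ ≤ 1 ∧
      Integrable (fun p => Real.log (f p)) ρ ∧ a < ∫ p, Real.log (f p) ∂ρ := by
  have hN : ∃ N, MeasurableSet N ∧ μ N = 0 ∧ ρ N ≠ 0 := by
    by_contra! hcon
    exact h (Measure.AbsolutelyContinuous.mk hcon)
  obtain ⟨N, hN, hμ, hρ⟩ := hN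
  have hpos : 0 < ρ.real N := ENNReal.toReal_pos hρ (measure_ne_top _ _)
  set K : ℝ := (|a| + 1) / ρ.real N with hK
  have hlog : (fun p => Real.log (Real.exp (N.indicator (fun _ => K) p))) =
      N.indicator fun _ => K := funext fun p => Real.log_exp _
  refine ⟨fun p => Real.exp (N.indicator (fun _ => K) p),
    Real.measurable_exp.comp (measurable_const.indicator hN),
    Eventually.of_forall fun _ => Real.exp_pos _, ?_, ?_, ?_⟩
  · have hae : ∀ᵐ p ∂μ, p ∉ N := measure_eq_zero_iff_ae_notMem.1 hμ
    refine le_of_eq ((lintegral_congr_ae (g := fun _ => 1) ?_).trans (by simp))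
    filter_upwards [hae] with p hp
    simp [hp]
  · rw [hlog]
    exact (integrable_const K).indicator hN
  · rw [hlog, integral_indicator_const _ hN, smul_eq_mul, hK, mul_div_cancel₀ _ hpos.ne']
    linarith [le_abs_self a]

/-- Truncate the density r to min(max(1, r), n + 1) and halve it. Its `μ`-mean is at most (1 + 1)/2,
and the `ρ`-mean of its logarithm tends to infinity by monotone convergence. -/
theorem exists_test_of_klDiv_eq_top {Ω : Type*} [MeasurableSpace Ω] (ρ μ : Measure Ω)
    [IsProbabilityMeasure ρ] [IsProbabilityMeasure μ] (hac : ρ ≪ μ)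
    (h : InformationTheory.klDiv ρ μ = ⊤) (a : ℝ) :
    ∃ f : Ω → ℝ, Measurable f ∧ (∀ᵐ p ∂ρ, 0 < f p) ∧ ∫⁻ p, ENNReal.ofReal (f p) ∂μ ≤ 1 ∧
      Integrable (fun p => Real.log (f p)) ρ ∧ a < ∫ p, Real.log (f p) ∂ρ := by
  set r : Ω → ℝ := fun p => (ρ.rnDeriv μ p).toReal
  have hr : Measurable r := (Measure.measurable_rnDeriv ρ μ).ennreal_toReal
  -- From r log r + 1 - r ≤ r log max(1, r) + 1, integrated against `μ`: the divergence exceeds this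
  -- integral by at most 1.
  have hinf : ∫⁻ p, ENNReal.ofReal (Real.log (max 1 (r p))) ∂ρ = ⊤ := by
    rw [← top_le_iff, ← ENNReal.add_le_add_iff_right ENNReal.one_ne_top, top_add, ← h,
      InformationTheory.klDiv_eq_lintegral_klFun_of_ac hac,
      ← lintegral_rnDeriv_mul hac (by fun_prop)]
    have h1 : ∫⁻ _, (1 : ℝ≥0∞) ∂μ = 1 := by simp
    rw [← h1, ← lintegral_add_right _ measurable_const]
    refine lintegral_mono_ae ?_
    filter_upwards [Measure.rnDeriv_lt_top ρ μ] with p hp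
    have h0 : 0 ≤ r p := ENNReal.toReal_nonneg
    have h2 : ρ.rnDeriv μ p = ENNReal.ofReal (r p) := (ENNReal.ofReal_toReal hp.ne).symm
    have h3 : 0 ≤ Real.log (max 1 (r p)) := Real.log_nonneg (le_max_left _ _)
    change ENNReal.ofReal (InformationTheory.klFun (r p)) ≤ _
    rw [h2, ← ENNReal.ofReal_mul h0, ← ENNReal.ofReal_one,
      ← ENNReal.ofReal_add (by positivity) zero_le_one]
    refine ENNReal.ofReal_le_ofReal ?_
    rw [InformationTheory.klFun]
    have h4 : r p * Real.log (r p) ≤ r p * Real.log (max 1 (r p)) := by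
      rcases h0.eq_or_lt with h5 | h5
      · rw [← h5]
        simp
      · exact mul_le_mul_of_nonneg_left (Real.log_le_log h5 (le_max_right _ _)) h0
    linarith
  set q : ℕ → Ω → ℝ := fun n p => min (max 1 (r p)) (n + 1) with hq
  have hqm : ∀ n, Measurable (q n) := fun n => by fun_prop
  have hq1 : ∀ n p, 1 ≤ q n p := fun n p => le_min (le_max_left _ _) (by simp)
  have hmono : ∀ p, Monotone fun n => q n p := fun p m n hmn =>
    min_le_min_left _ (by gcongr)
  have hlim : Tendsto (fun n => ∫⁻ p, ENNReal.ofReal (Real.log (q n p)) ∂ρ) atTop (𝓝 ⊤) := by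
    rw [← hinf]
    refine lintegral_tendsto_of_tendsto_of_monotone (fun n => by fun_prop)
      (Eventually.of_forall fun p m n hmn => ENNReal.ofReal_le_ofReal
        (Real.log_le_log (zero_lt_one.trans_le (hq1 m p)) (hmono p hmn)))
      (Eventually.of_forall fun p => ?_)
    refine tendsto_const_nhds.congr' ?_
    obtain ⟨m, hm⟩ := exists_nat_ge (max 1 (r p))
    filter_upwards [eventually_ge_atTop m] with n hn
    have : (m : ℝ) ≤ n := by exact_mod_cast hn
    rw [hq]
    dsimp only
    rw [min_eq_left (by linarith)]
  -- The log 2 pays for the halving.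
  obtain ⟨n, hn⟩ := (hlim.eventually (lt_mem_nhds
    (ENNReal.ofReal_lt_top (r := a + Real.log 2)))).exists
  have hlogint : Integrable (fun p => Real.log (q n p)) ρ := by
    refine Integrable.of_bound (C := Real.log (n + 1))
      (Real.measurable_log.comp (hqm n)).aestronglyMeasurable
      (Eventually.of_forall fun p => ?_)
    rw [Real.norm_of_nonneg (Real.log_nonneg (hq1 n p))]
    exact Real.log_le_log (zero_lt_one.trans_le (hq1 n p)) (min_le_right _ _)
  have hlog : (fun p => Real.log (q n p / 2)) = fun p => Real.log (q n p) - Real.log 2 :=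
    funext fun p => Real.log_div (zero_lt_one.trans_le (hq1 n p)).ne' two_ne_zero
  refine ⟨fun p => q n p / 2, (hqm n).div_const 2,
    Eventually.of_forall fun p => half_pos (zero_lt_one.trans_le (hq1 n p)), ?_, ?_, ?_⟩
  · have h1 : ∀ p, ENNReal.ofReal (q n p / 2) ≤ (1 + ρ.rnDeriv μ p) / 2 := by
      intro p
      rw [ENNReal.ofReal_div_of_pos two_pos, ENNReal.ofReal_ofNat]
      refine ENNReal.div_le_div_right ?_ _
      calc ENNReal.ofReal (q n p) ≤ ENNReal.ofReal (1 + r p) := by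
            refine ENNReal.ofReal_le_ofReal ((min_le_left _ _).trans (max_le ?_ ?_))
            · linarith [show 0 ≤ r p from ENNReal.toReal_nonneg]
            · linarith
        _ ≤ _ := by
            rw [ENNReal.ofReal_add zero_le_one ENNReal.toReal_nonneg, ENNReal.ofReal_one]
            exact add_le_add_right ENNReal.ofReal_toReal_le _
    refine (lintegral_mono h1).trans ?_
    simp_rw [div_eq_mul_inv]
    rw [lintegral_mul_const _ (by fun_prop), lintegral_add_left measurable_const,
      Measure.lintegral_rnDeriv hac]
    simp [one_add_one_eq_two, ENNReal.mul_inv_cancel]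
  · rw [hlog]
    exact hlogint.sub (integrable_const _)
  · rw [hlog, integral_sub hlogint (integrable_const _)]
    rw [← ofReal_integral_eq_lintegral_ofReal hlogint
      (Eventually.of_forall fun p => Real.log_nonneg (hq1 n p))] at hn
    have := (ENNReal.ofReal_lt_ofReal_iff'.1 hn).1
    simp
    linarith

theorem mutualInfo_le_spectralInf_iidPairs (ρ : Measure (A × B)) [IsProbabilityMeasure ρ] :
    (mutualInfo ρ : EReal) ≤ spectralInf (iidPairs ρ) := by
  refine le_of_forall_lt_imp_le_of_dense fun c hc => ?_
  obtain ⟨a, hca, ha⟩ := EReal.lt_iff_exists_real_btwn.1 hc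
  refine hca.le.trans ?_
  obtain ⟨f, hf, hpos, hle, hint, hmean⟩ : ∃ f : A × B → ℝ, Measurable f ∧ (∀ᵐ p ∂ρ, 0 < f p) ∧
      ∫⁻ p, ENNReal.ofReal (f p) ∂prodMarginals ρ ≤ 1 ∧
      Integrable (fun p => Real.log (f p)) ρ ∧ a < ∫ p, Real.log (f p) ∂ρ := by
    by_cases htop : mutualInfo ρ = ⊤
    · by_cases hac : ρ ≪ prodMarginals ρ
      · exact exists_test_of_klDiv_eq_top _ _ hac htop a
      · exact exists_test_of_not_ac _ _ hac a
    · obtain ⟨hac, hint⟩ := InformationTheory.klDiv_ne_top_iff.1 htop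
      rw [toReal_mutualInfo htop] at ha
      refine ⟨fun p => (ρ.rnDeriv (prodMarginals ρ) p).toReal,
        (Measure.measurable_rnDeriv _ _).ennreal_toReal, ?_, ?_, hint, by exact_mod_cast ha⟩
      · filter_upwards [Measure.rnDeriv_pos hac, hac.ae_le (Measure.rnDeriv_lt_top ρ _)] with p h1 h2
        exact ENNReal.toReal_pos h1.ne' h2.ne
      · refine (lintegral_mono fun p => ENNReal.ofReal_toReal_le).trans ?_
        rw [Measure.lintegral_rnDeriv hac, measure_univ]
  exact le_spectralInf_iidPairs ρ hf hpos hle hint hmean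

end Memoryless

/-! ### Memoryless test channels and the single-letter bound -/

section ProductTestChannel

/-- The memoryless extension of a kernel. -/
noncomputable def memorylessKernel {A B : Type*} [MeasurableSpace A] [MeasurableSpace B]
    (κ : Kernel A B) [IsMarkovKernel κ] (n : ℕ) : Kernel (Fin n → A) (Fin n → B) where
  toFun a := Measure.pi fun i => κ (a i)
  measurable' := by
    refine Measurable.measure_of_isPiSystem_of_isProbabilityMeasure generateFrom_pi.symm
      isPiSystem_pi ?_
    rintro _ ⟨t, ht, rfl⟩
    simp_rw [Measure.pi_pi]
    exact Finset.measurable_fun_prod _ fun i _ =>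
      (κ.measurable_coe (ht i (Set.mem_univ i))).comp (measurable_pi_apply i)

variable {𝒮 : Type u} {𝒳 : Type v} {𝒴 : Type w} {𝒰 : Type z}
  [MeasurableSpace 𝒮] [MeasurableSpace 𝒳] [MeasurableSpace 𝒴] [MeasurableSpace 𝒰]

instance {A B : Type*} [MeasurableSpace A] [MeasurableSpace B]
    (κ : Kernel A B) [IsMarkovKernel κ] (n : ℕ) : IsMarkovKernel (memorylessKernel κ n) :=
  ⟨fun a => inferInstanceAs (IsProbabilityMeasure (Measure.pi fun i => κ (a i)))⟩

/-- The memoryless extension of a test channel. -/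
noncomputable def TestChannel.memoryless (V : TestChannel 𝒮 𝒳 𝒰) (n : ℕ) :
    TestChannel (Fin n → 𝒮) (Fin n → 𝒳) (Fin n → 𝒰) where
  auxKernel := memorylessKernel V.auxKernel n
  inputKernel := (memorylessKernel V.inputKernel n).comap (fun p i => (p.1 i, p.2 i)) (by fun_prop)
  markov_aux := inferInstance
  markov_input := inferInstance

/-- A law of pairs of words is that of i.i.d. pairs if it has the right value on product sets. -/
theorem eq_iidPairs {A B : Type*} [MeasurableSpace A] [MeasurableSpace B] {ρ : Measure (A × B)}
    [IsProbabilityMeasure ρ] {n : ℕ} {μ : Measure ((Fin n → A) × (Fin n → B))}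
    (h : ∀ R : Fin n → Set (A × B), (∀ i, MeasurableSet (R i)) →
      μ {p | ∀ i, (p.1 i, p.2 i) ∈ R i} = ∏ i, ρ (R i)) : μ = iidPairs ρ n := by
  set φ := MeasurableEquiv.arrowProdEquivProdArrow A B (Fin n)
  have h1 : Measure.pi (fun _ : Fin n => ρ) = μ.map φ.symm := by
    refine Measure.pi_eq fun R hR => ?_
    rw [MeasurableEquiv.map_apply, ← h R hR]
    congr 1
    ext p
    simp only [Set.mem_preimage, Set.mem_pi, Set.mem_univ, true_implies]
    rfl
  rw [iidPairs, h1, Measure.map_map φ.measurable φ.symm.measurable, φ.self_comp_symm,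
    Measure.map_id]

theorem measurableSet_forall_mem {A B : Type*} [MeasurableSpace A] [MeasurableSpace B] {n : ℕ}
    {R : Fin n → Set (A × B)} (hR : ∀ i, MeasurableSet (R i)) :
    MeasurableSet {p : (Fin n → A) × (Fin n → B) | ∀ i, (p.1 i, p.2 i) ∈ R i} := by
  rw [Set.ofPred_forall]
  exact MeasurableSet.iInter fun i => (by fun_prop : Measurable
    fun p : (Fin n → A) × (Fin n → B) => (p.1 i, p.2 i)) (hR i)

theorem ofPred_forall_eq_pi {B : Type*} {n : ℕ} (E : Fin n → Set B) :
    {y : Fin n → B | ∀ i, y i ∈ E i} = Set.univ.pi E := by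
  ext y
  simp

theorem lawUS_memoryless (p : Measure 𝒮) [IsProbabilityMeasure p] (V : TestChannel 𝒮 𝒳 𝒰) (n : ℕ) :
    lawUS (Measure.pi fun _ => p) (V.memoryless n) = iidPairs (lawUS p V) n := by
  refine eq_iidPairs fun R hR => ?_
  rw [lawUS_apply _ _ (measurableSet_forall_mem hR)]
  have h1 : ∀ s : Fin n → 𝒮, (V.memoryless n).auxKernel s
      {u | (u, s) ∈ {p : (Fin n → 𝒰) × (Fin n → 𝒮) | ∀ i, (p.1 i, p.2 i) ∈ R i}} =
      ∏ i, V.auxKernel (s i) {u | (u, s i) ∈ R i} := fun s => by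
    rw [← Measure.pi_pi, ← ofPred_forall_eq_pi]
    rfl
  simp_rw [h1]
  rw [lintegral_pi_prod (fun _ : Fin n => p) (f := fun i s => V.auxKernel s {u | (u, s) ∈ R i})
    fun i => Kernel.measurable_kernel_prodMk_left (measurable_swap (hR i))]
  exact Finset.prod_congr rfl fun i _ => (lawUS_apply p V (hR i)).symm

/-- On sets defined by one condition per coordinate, the integrals over inputs, auxiliary letters
and states factor in turn, and such sets determine the law. -/
theorem lawUY_memoryless (p : Measure 𝒮) [IsProbabilityMeasure p] (V : TestChannel 𝒮 𝒳 𝒰)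
    (w : Kernel (𝒳 × 𝒮) 𝒴) [IsMarkovKernel w] {n : ℕ}
    (W : Kernel ((Fin n → 𝒳) × (Fin n → 𝒮)) (Fin n → 𝒴)) [IsMarkovKernel W]
    (hW : ∀ x s, W (x, s) = Measure.pi fun i => w (x i, s i)) :
    lawUY (Measure.pi fun _ => p) (V.memoryless n) W = iidPairs (lawUY p V w) n := by
  have hout : ∀ (s : Fin n → 𝒮) (u : Fin n → 𝒰) (E : Fin n → Set 𝒴), (∀ i, MeasurableSet (E i)) →
      (V.memoryless n).outKernel W (s, u) (Set.univ.pi E) =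
        ∏ i, V.outKernel w (s i, u i) (E i) := by
    intro s u E hE
    rw [outKernel_apply _ _ _ (MeasurableSet.univ_pi hE)]
    simp_rw [hW, Measure.pi_pi]
    refine (lintegral_pi_prod (fun i : Fin n => V.inputKernel (s i, u i))
      (f := fun i x => w (x, s i) (E i)) fun i =>
        (w.measurable_coe (hE i)).comp measurable_prodMk_right).trans ?_
    exact Finset.prod_congr rfl fun i _ => (outKernel_apply V w (s i, u i) (hE i)).symm
  refine eq_iidPairs fun R hR => ?_
  rw [lawUY_apply _ _ _ (measurableSet_forall_mem hR)]
  have hslice : ∀ i, Measurable fun q : 𝒰 × 𝒮 => V.outKernel w (q.2, q.1) {y | (q.1, y) ∈ R i} :=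
    fun i => measurable_outKernel_slice V w (hR i)
  have h1 : ∀ s : Fin n → 𝒮, ∫⁻ u, (V.memoryless n).outKernel W (s, u)
      {y | (u, y) ∈ {p : (Fin n → 𝒰) × (Fin n → 𝒴) | ∀ i, (p.1 i, p.2 i) ∈ R i}}
        ∂(V.memoryless n).auxKernel s =
      ∏ i, ∫⁻ u, V.outKernel w (s i, u) {y | (u, y) ∈ R i} ∂V.auxKernel (s i) := by
    intro s
    refine Eq.trans (lintegral_congr fun u => ?_) (lintegral_pi_prod
      (fun i => V.auxKernel (s i)) (f := fun i u => V.outKernel w (s i, u) {y | (u, y) ∈ R i})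
      fun i => (hslice i).comp measurable_prodMk_right)
    rw [← hout s u (fun i => {y | (u i, y) ∈ R i}) fun i => measurable_prodMk_left (hR i),
      ← ofPred_forall_eq_pi]
    rfl
  simp_rw [h1]
  rw [lintegral_pi_prod (fun _ : Fin n => p)
    (f := fun i s => ∫⁻ u, V.outKernel w (s, u) {y | (u, y) ∈ R i} ∂V.auxKernel s)
    fun i => Measurable.lintegral_kernel_prod_right' (κ := V.auxKernel)
      (f := fun q : 𝒮 × 𝒰 => V.outKernel w (q.1, q.2) {y | (q.2, y) ∈ R i})
      ((hslice i).comp measurable_swap)]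
  exact Finset.prod_congr rfl fun i _ => (lawUY_apply p V w (hR i)).symm

/-- The two comparisons of spectral rates with mutual information are applied to each component; the
same memoryless test channel serves them all. -/
theorem singleLetterValue_le_spectralValue (α β : ℕ → ℝ≥0)
    (W : ℕ → ∀ n, Kernel ((Fin n → 𝒳) × (Fin n → 𝒮)) (Fin n → 𝒴))
    (hW : ∀ k n, IsMarkovKernel (W k n))
    (P : ℕ → ∀ n, Measure (Fin n → 𝒮))
    (w : ℕ → Kernel (𝒳 × 𝒮) 𝒴) (p : ℕ → Measure 𝒮) (hw : ∀ k, IsMarkovKernel (w k))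
    (hp : ∀ l, IsProbabilityMeasure (p l)) (hWw : ∀ k, IsMemorylessChannel (W k) (w k))
    (hPp : ∀ l, IsIIDState (P l) (p l)) (V : TestChannel 𝒮 𝒳 𝒰) :
    singleLetterValue α β w p V ≤ spectralValue α β W P fun n => V.memoryless n := by
  refine EReal.sub_le_sub (le_iInf₂ fun q hq => ?_) (iSup₂_le fun l hl => ?_)
  · have h1 : (fun n => lawUY (P q.2 n) (V.memoryless n) (W q.1 n)) =
        iidPairs (lawUY (p q.2) V (w q.1)) := funext fun n => by
      rw [hPp q.2 n]
      exact lawUY_memoryless (p q.2) V (w q.1) (W q.1 n) (hWw q.1 n)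
    rw [h1]
    exact (EReal.coe_ennreal_le_coe_ennreal_iff.2 (iInf₂_le q hq)).trans
      (mutualInfo_le_spectralInf_iidPairs _)
  · have h1 : (fun n => lawUS (P l n) (V.memoryless n)) = iidPairs (lawUS (p l) V) :=
      funext fun n => by rw [hPp l n, lawUS_memoryless]
    rw [h1]
    exact (spectralSup_iidPairs_le_mutualInfo _).trans (EReal.coe_ennreal_le_coe_ennreal_iff.2
      (le_iSup₂ (f := fun l (_ : l ∈ {l | 0 < β l}) => mutualInfo (lawUS (p l) V)) l hl))

end ProductTestChannel

end GP

theorem corollary4 {𝒮 : Type u} {𝒳 : Type v} {𝒴 : Type w}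
    [MeasurableSpace 𝒮] [MeasurableSpace 𝒳] [MeasurableSpace 𝒴] [Nonempty 𝒳]
    (α β : ℕ → ℝ≥0) (hα : HasSum α 1) (hβ : HasSum β 1)
    (W : ℕ → ∀ n, Kernel ((Fin n → 𝒳) × (Fin n → 𝒮)) (Fin n → 𝒴))
    (hW : ∀ k n, IsMarkovKernel (W k n))
    (P : ℕ → ∀ n, Measure (Fin n → 𝒮))
    (hP : ∀ l n, IsProbabilityMeasure (P l n)) :
    GP.capacity (GP.mixChannel α W) (GP.mixState β P) =
        (⨆ (𝒰 : Type z) (_ : MeasurableSpace 𝒰)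
          (V : ∀ n, GP.TestChannel (Fin n → 𝒮) (Fin n → 𝒳) (Fin n → 𝒰)),
          GP.spectralValue α β W P V) ∧
      ∀ (w : ℕ → Kernel (𝒳 × 𝒮) 𝒴) (p : ℕ → Measure 𝒮),
        (∀ k, IsMarkovKernel (w k)) → (∀ l, IsProbabilityMeasure (p l)) →
        (∀ k, GP.IsMemorylessChannel (W k) (w k)) → (∀ l, GP.IsIIDState (P l) (p l)) →
        (⨆ (𝒰 : Type z) (_ : MeasurableSpace 𝒰) (V : GP.TestChannel 𝒮 𝒳 𝒰),
          GP.singleLetterValue α β w p V) ≤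
          GP.capacity (GP.mixChannel α W) (GP.mixState β P) := by
  refine ⟨le_antisymm (GP.capacity_le_iSup_spectralValue α β W hW P hP)
    (iSup_le fun 𝒰 => iSup_le fun _ => iSup_le fun V =>
      GP.spectralValue_le_capacity α β hα hβ W hW P hP V), fun w p hw hp hWw hPp =>
    iSup_le fun 𝒰 => iSup_le fun _ => iSup_le fun V => ?_⟩
  exact (GP.singleLetterValue_le_spectralValue α β W hW P w p hw hp hWw hPp V).trans
    (GP.spectralValue_le_capacity α β hα hβ W hW P hP _)
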